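/- Let $q$ be a power of an odd prime $p$, let $n\ge 2$, and let $F$ be a field of characteristic $2$ together with a non-trivial character $\lambda:(\mathbb F_q,+)\to F^*$. Let $V$ be a $2n$-dimensional $\mathbb F_q$-space with symplectic basis $u_1,\dots,u_n,v_1,\dots,v_n$, i.e. $\langle u_i,v_j\rangle=\delta_{ij}$ and $\langle u_i,u_j\rangle=\langle v_i,v_j\rangle=0$ for an alternating form $\langle\ ,\ \rangle$, and let $\mathrm{Sp}=\mathrm{Sp}_{2n}(q)$ be its isometry group; matrices are taken with respect to this basis. Consider in $\mathrm{Sp}$: - the group $\mathrm{Sp}^M$ of elements fixing $u_1,\dots,u_n$; the group $T$ of elements with matrix $\mathrm{diag}(A,{}^tA^{-1})$, $A\in \mathrm{GL}_n(q)$ upper triangular with $1$'s on the diagonal; $U=T\,\mathrm{Sp}^M$ (a Sylow $p$-subgroup); the group $H$ of elements having all $u_i,v_i$ as eigenvectors; $B=UH$; - for $1\le i<n$ the element $w_i=(u_i,u_{i+1})(v_i,v_{i+1})$ permuting the basis; for $1\le j\le n$ the element $c_j$ with $c_j(u_j)=v_j$, $c_j(v_j)=-u_j$, fixing all other basis vectors;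 and, for $\alpha\in\mathbb F_q$, the element $x_{n-1,n}(\alpha)$ with matrix $\mathrm{diag}(A,{}^tA^{-1})$, where $A$ has $1$'s on the diagonal, $A_{n-1,n}=\alpha$ and zeros elsewhere; - the group $W_2=\langle w_1,\dots,w_{n-1},c_1,\dots,c_n\rangle$ and the Weyl group $W=W_2/(W_2\cap H)$, with length function $\ell$ relative to the generators given by the classes of $w_1,\dots,w_{n-1},c_n$. For each $w\in W$ choose a representative $n_w\in W_2$. In the group algebra $F\,\mathrm{Sp}$ put $$e=\Big(\sum_{w\in W}(-1)^{\ell(w)}n_w\Big)\sum_{b\in B}b ,$$ and let $I=F\,\mathrm{Sp}\cdot e$ be the (left) Steinberg module. Let $\chi(g)=\lambda(\langle g v_n,v_n\rangle)$ and $$e_\chi=\sum_{u\in U}\chi(u)^{-1}\,u e\in I .$$ Then the following identity holds in $I$: $$c_{n-1}\,e_\chi=\sum_{\alpha\in\mathbb F_q} w_{n-1}\,x_{n-1,n}(-\alpha)\,w_{n-1}\,e_\chi .$$ -/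

import Mathlib

open Matrix

namespace SpSteinberg

/-- The symplectic group `Sp_{2n}(K)`, written in a symplectic basis
`u_1, …, u_n, v_1, …, v_n`: the index `Sum.inl i` is `u_i`, the index `Sum.inr i` is `v_i`,
and matrices act on column vectors. (Indices run over `Fin n`, so they start at `0`.) -/
abbrev Sp (n : ℕ) (K : Type*) [CommRing K] : Type _ := Matrix.symplecticGroup (Fin n) K

section Group

variable {n : ℕ} {K : Type*} [Field K]

/-- The underlying matrix of an element of `Sp_{2n}(K)`. -/
abbrev mat (g : Sp n K) : Matrix (Fin n ⊕ Fin n) (Fin n ⊕ Fin n) K := g.1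

/-- The basis vector `u_i`. -/
def uVec (i : Fin n) : Fin n ⊕ Fin n → K := Pi.single (Sum.inl i) 1

/-- The basis vector `v_i`. -/
def vVec (i : Fin n) : Fin n ⊕ Fin n → K := Pi.single (Sum.inr i) 1

/-- The alternating form with `⟨u_i, v_j⟩ = δ_ij`, `⟨u_i, u_j⟩ = ⟨v_i, v_j⟩ = 0`. -/
def form (x y : Fin n ⊕ Fin n → K) : K :=
  ∑ i, (x (Sum.inl i) * y (Sum.inr i) - x (Sum.inr i) * y (Sum.inl i))

/-- `Sp_{2n}(K)` is the isometry group of `form`. -/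
theorem mem_symplecticGroup_iff_form (A : Matrix (Fin n ⊕ Fin n) (Fin n ⊕ Fin n) K) :
    A ∈ Matrix.symplecticGroup (Fin n) K ↔
      ∀ x y : Fin n ⊕ Fin n → K, form (A *ᵥ x) (A *ᵥ y) = form x y := by
  have hf : ∀ x y : Fin n ⊕ Fin n → K, form x y = - (x ⬝ᵥ (J (Fin n) K *ᵥ y)) := by
    intro x y
    simp [form, J, dotProduct, Matrix.fromBlocks_mulVec, Fintype.sum_sum_type,
      Matrix.neg_mulVec]
    ring
  have hA : ∀ x y : Fin n ⊕ Fin n → K,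
      form (A *ᵥ x) (A *ᵥ y) = - (x ⬝ᵥ ((Aᵀ * J (Fin n) K * A) *ᵥ y)) := by
    intro x y
    rw [hf, ← Matrix.mulVec_mulVec, ← Matrix.mulVec_mulVec, Matrix.dotProduct_mulVec x,
      Matrix.vecMul_transpose]
  rw [SymplecticGroup.mem_iff']
  constructor
  · intro h x y
    rw [hA, h, hf]
  · intro h
    ext i j
    have := h (Pi.single i 1) (Pi.single j 1)
    rw [hA, hf] at this
    simpa using this

/-- The element of `Sp_{M,N}` whose matrix is `diag(A, ᵗA⁻¹)`, `A ∈ GL_n(K)`. -/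
def levi : GL (Fin n) K →* Sp n K where
  toFun A := ⟨fromBlocks (A : Matrix (Fin n) (Fin n) K) 0 0
      ((A⁻¹ : GL (Fin n) K) : Matrix (Fin n) (Fin n) K)ᵀ, by
    rw [SymplecticGroup.fromBlocks_mem_iff]
    refine ⟨by simp, by simp, ?_⟩
    rw [← Matrix.transpose_mul, ← Units.val_mul]
    simp⟩
  map_one' := by
    apply Subtype.ext
    simp
  map_mul' A B := by
    apply Subtype.ext
    simp [Matrix.fromBlocks_multiply]

/-- Upper triangular matrices with `1`'s on the diagonal. -/
def unitriangular : Subgroup (GL (Fin n) K) where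
  carrier := {A | (∀ i j, j < i → A i j = 0) ∧ ∀ i, A i i = 1}
  one_mem' := ⟨fun i j h => by simp [h.ne'], fun i => by simp⟩
  mul_mem' {A B} hA hB := by
    constructor
    · intro i j h
      rw [Units.val_mul, Matrix.mul_apply]
      refine Finset.sum_eq_zero fun k _ => ?_
      rcases lt_or_ge k i with hk | hk
      · rw [hA.1 i k hk, zero_mul]
      · rw [hB.1 k j (h.trans_le hk), mul_zero]
    · intro i
      rw [Units.val_mul, Matrix.mul_apply, Finset.sum_eq_single i]
      · rw [hA.2, hB.2, one_mul]
      · intro k _ hk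
        rcases lt_or_gt_of_ne hk with hk | hk
        · rw [hA.1 i k hk, zero_mul]
        · rw [hB.1 k i hk, mul_zero]
      · simp
  inv_mem' {A} hA := by
    have htri : (A : Matrix (Fin n) (Fin n) K).BlockTriangular id := fun i j h => hA.1 i j h
    have hinv : ((A⁻¹ : GL (Fin n) K) : Matrix (Fin n) (Fin n) K).BlockTriangular id := by
      rw [Matrix.coe_units_inv]
      have : Invertible (A : Matrix (Fin n) (Fin n) K) := A.invertible
      exact Matrix.blockTriangular_inv_of_blockTriangular htri
    refine ⟨fun i j h => hinv h, fun i => ?_⟩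
    have h1 : ((A * A⁻¹ : GL (Fin n) K) : Matrix (Fin n) (Fin n) K) i i = 1 := by simp
    rw [Units.val_mul, Matrix.mul_apply, Finset.sum_eq_single i] at h1
    · rwa [hA.2, one_mul] at h1
    · intro k _ hk
      rcases lt_or_gt_of_ne hk with hk | hk
      · rw [hA.1 i k hk, zero_mul]
      · rw [hinv hk, mul_zero]
    · simp

/-- The group `T`. -/
def T (n : ℕ) (K : Type*) [Field K] : Subgroup (Sp n K) := unitriangular.map levi

/-- The group `Sp^M`, the pointwise stabilizer of `M = span {u_1, …, u_n}`. -/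
def SpM (n : ℕ) (K : Type*) [Field K] : Subgroup (Sp n K) where
  carrier := {g | ∀ i, mat g *ᵥ uVec i = uVec i}
  one_mem' := fun i => by simp [mat]
  mul_mem' {g h} hg hh := fun i => by
    have : mat (g * h) = mat g * mat h := rfl
    rw [this, ← Matrix.mulVec_mulVec, hh, hg]
  inv_mem' {g} hg := fun i => by
    have : mat g⁻¹ * mat g = 1 := congrArg Subtype.val (inv_mul_cancel g)
    conv_lhs => rw [← hg i]
    rw [Matrix.mulVec_mulVec, this, Matrix.one_mulVec]

/-- The `p`-Sylow subgroup `U = T Sp^M` (a semidirect product). -/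
def U (n : ℕ) (K : Type*) [Field K] : Subgroup (Sp n K) := T n K ⊔ SpM n K

/-- The group `H` of all symplectic maps for which every `u_i` and every `v_i` is an
eigenvector. -/
def H (n : ℕ) (K : Type*) [Field K] : Subgroup (Sp n K) where
  carrier := {g | (mat g).IsDiag}
  one_mem' := Matrix.isDiag_one
  mul_mem' {g h} hg hh := by
    have : mat (g * h) = mat g * mat h := rfl
    rw [Set.mem_ofPred_eq, this, ← hg.diagonal_diag, ← hh.diagonal_diag,
      Matrix.diagonal_mul_diagonal]
    exact Matrix.isDiag_diagonal _
  inv_mem' {g} hg := by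
    have : mat g⁻¹ = (mat g)⁻¹ := SymplecticGroup.coe_inv' g
    rw [Set.mem_ofPred_eq, this, ← Matrix.IsDiag.diagonal_diag hg, Matrix.inv_diagonal]
    exact Matrix.isDiag_diagonal _

/-- The group `B = U H` (a semidirect product). -/
def B (n : ℕ) (K : Type*) [Field K] : Subgroup (Sp n K) := U n K ⊔ H n K

/-- The element `(u_i, u_j)(v_i, v_j)` of `Sp`, permuting the symplectic basis. For
`j = i + 1` this is `w_i`. -/
def w (i j : Fin n) : Sp n K :=
  ⟨fromBlocks ((Equiv.swap i j).permMatrix K) 0 0 ((Equiv.swap i j).permMatrix K), by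
    rw [SymplecticGroup.fromBlocks_mem_iff]
    refine ⟨by simp, by simp, ?_⟩
    rw [Matrix.transpose_permMatrix, ← Matrix.permMatrix_mul]
    simp⟩

/-- The element `c_j` of `Sp`: `u_j ↦ v_j`, `v_j ↦ -u_j`, all other basis vectors fixed. -/
def c (j : Fin n) : Sp n K :=
  ⟨fromBlocks (1 - Matrix.single j j 1) (-Matrix.single j j 1)
      (Matrix.single j j 1) (1 - Matrix.single j j 1), by
    rw [SymplecticGroup.fromBlocks_mem_iff]
    refine ⟨?_, ?_, ?_⟩ <;> simp [mul_sub, sub_mul]⟩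

/-- The root element `x_{i,j}(α)`, `i < j ≤ n`: its matrix is `diag(A, ᵗA⁻¹)` where `A` has
`1`'s on the diagonal, `A_{ij} = α`, and zeros elsewhere. -/
def x (i j : Fin n) (h : (i : ℕ) < j) (α : K) : Sp n K :=
  levi ⟨Matrix.transvection i j α, Matrix.transvection i j (-α),
    by rw [Matrix.transvection_mul_transvection_same i j (Fin.ne_of_lt h)]; simp,
    by rw [Matrix.transvection_mul_transvection_same i j (Fin.ne_of_lt h)]; simp⟩

/-- The set `{w_1, …, w_{n-1}, c_n}`. -/
def fundamental (n : ℕ) (K : Type*) [Field K] : Set (Sp n K) :=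
  {g | (∃ i j : Fin n, (i : ℕ) + 1 = j ∧ g = w i j) ∨ ∃ j : Fin n, (j : ℕ) + 1 = n ∧ g = c j}

/-- `W_0 = ⟨w_1, …, w_{n-1}⟩`. -/
def W₀ (n : ℕ) (K : Type*) [Field K] : Subgroup (Sp n K) :=
  Subgroup.closure {g | ∃ i j : Fin n, (i : ℕ) + 1 = j ∧ g = w i j}

/-- `W_1 = ⟨c_1, …, c_n⟩`. -/
def W₁ (n : ℕ) (K : Type*) [Field K] : Subgroup (Sp n K) :=
  Subgroup.closure (Set.range c)

/-- `W_2 = W_1 W_0` (a semidirect product). -/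
def W₂ (n : ℕ) (K : Type*) [Field K] : Subgroup (Sp n K) := W₁ n K ⊔ W₀ n K

/-- The Weyl group `W = W_2 / (W_2 ∩ H)`, as the set of cosets of `W_2 ∩ H` in `W_2`. -/
abbrev Weyl (n : ℕ) (K : Type*) [Field K] : Type _ := W₂ n K ⧸ (H n K).subgroupOf (W₂ n K)

/-- The length of `w ∈ W`: the length of a shortest word in the letters
`w_1 H, …, w_{n-1} H, c_n H` which is equal to `w`. -/
noncomputable def len (y : Weyl n K) : ℕ :=
  sInf {k | ∃ l : List (W₂ n K), (∀ s ∈ l, (s : Sp n K) ∈ fundamental n K) ∧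
    l.length = k ∧ (QuotientGroup.mk l.prod : Weyl n K) = y}

noncomputable instance [Finite K] (S : Subgroup (Sp n K)) : Fintype S := Fintype.ofFinite S

noncomputable instance [Finite K] : Fintype (Weyl n K) := Fintype.ofFinite _

end Group

section Module

variable {n : ℕ} {K : Type*} [Field K] [Finite K] (F : Type*) [Field F]

/-- The element `e = (∑_{w ∈ W} (-1)^{ℓ(w)} n_w) ∑_{b ∈ B} b` of the group algebra `F Sp`,
for a choice `r` of representatives `n_w ∈ W_2` of the elements `w ∈ W`. -/
noncomputable def steinbergElt (r : Weyl n K → W₂ n K) : MonoidAlgebra F (Sp n K) :=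
  (∑ y : Weyl n K, (-1 : F) ^ len y • MonoidAlgebra.of F (Sp n K) (r y)) *
    ∑ b : B n K, MonoidAlgebra.of F (Sp n K) b

/-- The (left) Steinberg module `I = F Sp · e`, a left ideal of `F Sp`. -/
noncomputable def steinbergModule (r : Weyl n K → W₂ n K) :
    Submodule (MonoidAlgebra F (Sp n K)) (MonoidAlgebra F (Sp n K)) :=
  Submodule.span (MonoidAlgebra F (Sp n K)) {steinbergElt F r}

/-- The generator `e`, as an element of `I`. -/
noncomputable def gen (r : Weyl n K → W₂ n K) : steinbergModule F r :=
  ⟨steinbergElt F r, Submodule.mem_span_singleton_self _⟩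

variable {F}

/-- The action of `g ∈ Sp` on the left `F Sp`-module `I`. -/
noncomputable def act {r : Weyl n K → W₂ n K} (g : Sp n K) (z : steinbergModule F r) :
    steinbergModule F r :=
  MonoidAlgebra.of F (Sp n K) g • z

/-- The function `χ_v(g) = λ(⟨gv, v⟩)` on `Sp`. -/
def chi (lam : AddChar K F) (v : Fin n ⊕ Fin n → K) (g : Sp n K) : F :=
  lam (form (mat g *ᵥ v) v)

/-- The element `e_σ = ∑_{u ∈ U} σ(u)⁻¹ u e` of `I`. -/
noncomputable def eChar (r : Weyl n K → W₂ n K) (σ : Sp n K → F) : steinbergModule F r :=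
  ∑ u : U n K, (σ u)⁻¹ • act (u : Sp n K) (gen F r)

end Module

end SpSteinberg

set_option linter.unusedSimpArgs false

/-! Since `w i j * c j * w i j = c i`, cancelling the outer `w i j` turns the claim into: with `y =
w e_χ`, the element `c_n y` equals the sum of `x(-α) y` over all `α`. Both sides have the shape `∑
f(u) u e` over `U`, so it suffices to compare coefficients.

In characteristic two the signs in `e` disappear: `e` is the sum of the chambers of the standard
apartment, and `W₂` fixes it. Cutting the apartment along the wall of a simple reflection `s` gives
`e = z + s z`, with `z` fixed by the root group `a` of `s` (`exists_half_apartment`). A computation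
in rank one then yields `s a(t) e = a(κ t⁻¹) e + e` for `t ≠ 0`, with `κ = 1` for `w` and `κ = -1`
for `c_n`. As `s` normalizes the complement of its root group in `U`, this relation determines how
`s` changes coefficients (`reflect_sum`).

Let `s, p, t, b` be the entries of `u` at `(u_i, v_i)`, `(u_i, u_j)`, `(u_i, v_j)`, `(u_j, v_j)`.
The coefficient of `u` in `w e_χ` is `lam (-(s + p t))`. Applying `c_n` on one side and summing over
`x(-α)` on the other leaves an identity of quadratic exponential sums over `K`
(`sum_addChar_quadratic`). It holds because a Gauss sum over a field of odd order collapses to `1`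
in characteristic two: the terms at `α` and `-α` cancel. -/

namespace SpSteinberg

/-! ### Entrywise effect of multiplying by the generators -/

section Entries

variable {n : ℕ} {K : Type*} [Field K]

/-- The long root element of `Sp`: `v_j ↦ v_j + b u_j`, all other basis vectors fixed. -/
def longRoot (j : Fin n) (b : K) : Sp n K :=
  ⟨fromBlocks 1 (Matrix.single j j b) 0 1, by
    rw [SymplecticGroup.fromBlocks_mem_iff]
    refine ⟨?_, ?_, ?_⟩ <;> simp⟩

theorem mat_mul (g h : Sp n K) : mat (g * h) = mat g * mat h := rfl

theorem w_mul_apply (i j : Fin n) (g : Sp n K) (P Q : Fin n ⊕ Fin n) :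
    mat (w i j * g) P Q = mat g (Sum.map (Equiv.swap i j) (Equiv.swap i j) P) Q := by
  rw [mat_mul, Matrix.mul_apply, Fintype.sum_sum_type]
  rcases P with k | k <;>
  simp [w, mat, Equiv.Perm.permMatrix, PEquiv.toMatrix_apply]

theorem mul_w_apply (i j : Fin n) (g : Sp n K) (P Q : Fin n ⊕ Fin n) :
    mat (g * w i j) P Q = mat g P (Sum.map (Equiv.swap i j) (Equiv.swap i j) Q) := by
  rw [mat_mul, Matrix.mul_apply, Fintype.sum_sum_type]
  rcases Q with k | k <;>
  simp [w, mat, Equiv.Perm.permMatrix, PEquiv.toMatrix_apply, Equiv.swap_apply_eq_iff]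

theorem mat_longRoot (j : Fin n) (b : K) :
    mat (longRoot j b) = fromBlocks 1 (Matrix.single j j b) 0 1 := rfl

theorem mat_c (j : Fin n) :
    mat (c j : Sp n K) = fromBlocks (1 - Matrix.single j j 1) (-Matrix.single j j 1)
      (Matrix.single j j 1) (1 - Matrix.single j j 1) := rfl

theorem mat_x (i j : Fin n) (h : (i : ℕ) < j) (a : K) :
    mat (x i j h a) =
      fromBlocks (transvection i j a) 0 0 (transvection j i (-a)) := by
  have : (transvection i j (-a))ᵀ = transvection j i (-a) := by
    simp [transvection]
  rw [← this]
  rfl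

theorem x_mul_apply_inl (i j : Fin n) (h : (i : ℕ) < j) (a : K) (g : Sp n K) (k : Fin n)
    (Q : Fin n ⊕ Fin n) :
    mat (x i j h a * g) (.inl k) Q =
      mat g (.inl k) Q + if k = i then a * mat g (.inl j) Q else 0 := by
  rw [mat_mul, Matrix.mul_apply, Fintype.sum_sum_type]
  by_cases hk : k = i
  · simp [hk, mat_x, transvection, one_apply, single_apply, add_mul,
      Finset.sum_add_distrib]
  · simp [hk, Ne.symm hk, mat_x, transvection, one_apply, single_apply, add_mul,
      Finset.sum_add_distrib]

theorem x_mul_apply_inr (i j : Fin n) (h : (i : ℕ) < j) (a : K) (g : Sp n K) (k : Fin n)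
    (Q : Fin n ⊕ Fin n) :
    mat (x i j h a * g) (.inr k) Q =
      mat g (.inr k) Q - if k = j then a * mat g (.inr i) Q else 0 := by
  rw [mat_mul, Matrix.mul_apply, Fintype.sum_sum_type]
  by_cases hk : k = j
  · simp [hk, mat_x, transvection, one_apply, single_apply, add_mul,
      Finset.sum_add_distrib, sub_eq_add_neg]
  · simp [hk, Ne.symm hk, mat_x, transvection, one_apply, single_apply, add_mul,
      Finset.sum_add_distrib, sub_eq_add_neg]

theorem mul_x_apply_inl (i j : Fin n) (h : (i : ℕ) < j) (a : K) (g : Sp n K) (k : Fin n)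
    (P : Fin n ⊕ Fin n) :
    mat (g * x i j h a) P (.inl k) =
      mat g P (.inl k) + if k = j then a * mat g P (.inl i) else 0 := by
  rw [mat_mul, Matrix.mul_apply, Fintype.sum_sum_type]
  by_cases hk : k = j
  · simp [hk, mat_x, transvection, one_apply, single_apply, mul_add,
      Finset.sum_add_distrib, mul_comm a]
  · simp [hk, Ne.symm hk, mat_x, transvection, one_apply, single_apply, mul_add,
      Finset.sum_add_distrib, mul_comm a]

theorem mul_x_apply_inr (i j : Fin n) (h : (i : ℕ) < j) (a : K) (g : Sp n K) (k : Fin n)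
    (P : Fin n ⊕ Fin n) :
    mat (g * x i j h a) P (.inr k) =
      mat g P (.inr k) - if k = i then a * mat g P (.inr j) else 0 := by
  rw [mat_mul, Matrix.mul_apply, Fintype.sum_sum_type]
  by_cases hk : k = i
  · simp [hk, mat_x, transvection, one_apply, single_apply, mul_add,
      Finset.sum_add_distrib, mul_comm a, sub_eq_add_neg]
  · simp [hk, Ne.symm hk, mat_x, transvection, one_apply, single_apply, mul_add,
      Finset.sum_add_distrib, mul_comm a, sub_eq_add_neg]

theorem longRoot_mul_apply_inl (j : Fin n) (b : K) (g : Sp n K) (k : Fin n)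
    (Q : Fin n ⊕ Fin n) :
    mat (longRoot j b * g) (.inl k) Q =
      mat g (.inl k) Q + if k = j then b * mat g (.inr j) Q else 0 := by
  rw [mat_mul, Matrix.mul_apply, Fintype.sum_sum_type]
  by_cases hk : k = j
  · simp [hk, mat_longRoot, one_apply, single_apply]
  · simp [hk, Ne.symm hk, mat_longRoot, one_apply, single_apply]

theorem longRoot_mul_apply_inr (j : Fin n) (b : K) (g : Sp n K) (k : Fin n)
    (Q : Fin n ⊕ Fin n) :
    mat (longRoot j b * g) (.inr k) Q = mat g (.inr k) Q := by
  rw [mat_mul, Matrix.mul_apply, Fintype.sum_sum_type]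
  simp [mat_longRoot, one_apply]

theorem mul_longRoot_apply_inl (j : Fin n) (b : K) (g : Sp n K) (k : Fin n)
    (P : Fin n ⊕ Fin n) :
    mat (g * longRoot j b) P (.inl k) = mat g P (.inl k) := by
  rw [mat_mul, Matrix.mul_apply, Fintype.sum_sum_type]
  simp [mat_longRoot, one_apply]

theorem mul_longRoot_apply_inr (j : Fin n) (b : K) (g : Sp n K) (k : Fin n)
    (P : Fin n ⊕ Fin n) :
    mat (g * longRoot j b) P (.inr k) =
      mat g P (.inr k) + if k = j then b * mat g P (.inl j) else 0 := by
  rw [mat_mul, Matrix.mul_apply, Fintype.sum_sum_type]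
  by_cases hk : k = j
  · simp [hk, mat_longRoot, one_apply, single_apply, mul_comm b, add_comm]
  · simp [hk, Ne.symm hk, mat_longRoot, one_apply, single_apply, mul_comm b, add_comm]

theorem c_mul_apply_inl (j : Fin n) (g : Sp n K) (k : Fin n) (Q : Fin n ⊕ Fin n) :
    mat (c j * g) (.inl k) Q = if k = j then -mat g (.inr j) Q else mat g (.inl k) Q := by
  rw [mat_mul, Matrix.mul_apply, Fintype.sum_sum_type]
  by_cases hk : k = j
  · simp [hk, mat_c, one_apply, single_apply, sub_mul]
  · simp [hk, Ne.symm hk, mat_c, one_apply, single_apply, sub_mul]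

theorem c_mul_apply_inr (j : Fin n) (g : Sp n K) (k : Fin n) (Q : Fin n ⊕ Fin n) :
    mat (c j * g) (.inr k) Q = if k = j then mat g (.inl j) Q else mat g (.inr k) Q := by
  rw [mat_mul, Matrix.mul_apply, Fintype.sum_sum_type]
  by_cases hk : k = j
  · simp [hk, mat_c, one_apply, single_apply, sub_mul]
  · simp [hk, Ne.symm hk, mat_c, one_apply, single_apply, sub_mul]

theorem mul_c_apply_inl (j : Fin n) (g : Sp n K) (k : Fin n) (P : Fin n ⊕ Fin n) :
    mat (g * c j) P (.inl k) = if k = j then mat g P (.inr j) else mat g P (.inl k) := by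
  rw [mat_mul, Matrix.mul_apply, Fintype.sum_sum_type]
  by_cases hk : k = j
  · simp [hk, mat_c, one_apply, single_apply, mul_sub]
  · simp [hk, Ne.symm hk, mat_c, one_apply, single_apply, mul_sub]

theorem mul_c_apply_inr (j : Fin n) (g : Sp n K) (k : Fin n) (P : Fin n ⊕ Fin n) :
    mat (g * c j) P (.inr k) = if k = j then -mat g P (.inl j) else mat g P (.inr k) := by
  rw [mat_mul, Matrix.mul_apply, Fintype.sum_sum_type]
  by_cases hk : k = j
  · simp [hk, mat_c, one_apply, single_apply, mul_sub]
  · simp [hk, Ne.symm hk, mat_c, one_apply, single_apply, mul_sub]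

theorem ext_mat {g h : Sp n K} (H : ∀ P Q, mat g P Q = mat h P Q) : g = h :=
  Subtype.ext (Matrix.ext H)

theorem w_mul_w (i j : Fin n) : (w i j * w i j : Sp n K) = 1 := by
  refine ext_mat fun P Q => ?_
  rw [← mul_one (w i j * w i j), mul_assoc, w_mul_apply, w_mul_apply]
  congr 1
  rcases P with k | k <;> simp

theorem w_mul_c_mul_w (i j : Fin n) : (w i j * c j * w i j : Sp n K) = c i := by
  refine ext_mat fun P Q => ?_
  rw [mul_w_apply, w_mul_apply]
  rcases P with k | k <;> rcases Q with l | l <;>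
    simp [c, mat, one_apply, single_apply, Equiv.swap_apply_eq_iff, eq_comm (a := j),
      eq_comm (a := i)]

theorem x_mul_x (i j : Fin n) (h : (i : ℕ) < j) (a b : K) :
    x i j h a * x i j h b = x i j h (a + b) := by
  rw [x, x, x, ← map_mul]
  congr 1
  exact Units.ext (transvection_mul_transvection_same i j (Fin.ne_of_lt h) a b)

theorem x_zero (i j : Fin n) (h : (i : ℕ) < j) : x i j h (0 : K) = 1 := by
  have := x_mul_x i j h (0 : K) 0
  simpa using this

theorem longRoot_mul_longRoot (j : Fin n) (a b : K) :
    longRoot j a * longRoot j b = longRoot j (a + b) := by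
  apply Subtype.ext
  change fromBlocks _ _ _ _ * fromBlocks _ _ _ _ = fromBlocks _ _ _ _
  simp [fromBlocks_multiply, ← single_add, add_comm]

theorem longRoot_zero (j : Fin n) : longRoot j (0 : K) = 1 := by
  have := longRoot_mul_longRoot j (0 : K) 0
  simpa using this

/-- The rows `u_k` and `u_l` of a symplectic matrix are orthogonal. -/
theorem row_inl_inl (g : Sp n K) (k l : Fin n) :
    ∑ m, (mat g (.inl k) (.inl m) * mat g (.inl l) (.inr m) -
      mat g (.inl k) (.inr m) * mat g (.inl l) (.inl m)) = 0 := by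
  have h := congrFun (congrFun ((SymplecticGroup.mem_iff).1 g.2) (.inl k)) (.inl l)
  rw [Matrix.mul_assoc, Matrix.mul_apply, Fintype.sum_sum_type] at h
  simp [J, Matrix.mul_apply, Fintype.sum_sum_type, one_apply] at h
  rw [Finset.sum_sub_distrib, ← neg_eq_zero, ← h]
  ring

theorem row_inl_inr (g : Sp n K) (k l : Fin n) :
    ∑ m, (mat g (.inl k) (.inl m) * mat g (.inr l) (.inr m) -
      mat g (.inl k) (.inr m) * mat g (.inr l) (.inl m)) = if k = l then 1 else 0 := by
  have h := congrFun (congrFun ((SymplecticGroup.mem_iff).1 g.2) (.inl k)) (.inr l)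
  rw [Matrix.mul_assoc, Matrix.mul_apply, Fintype.sum_sum_type] at h
  simp [J, Matrix.mul_apply, Fintype.sum_sum_type, one_apply] at h
  rw [Finset.sum_sub_distrib, ← neg_inj, ← h]
  ring

end Entries

/-! ### `U` and `B` as triangular matrices; monomial matrices -/

section Shapes

variable {n : ℕ} {K : Type*} [Field K]

/-- The position of a basis vector in the flag order `u_1, …, u_n, v_n, …, v_1`. -/
def flagPos : Fin n ⊕ Fin n → ℕ := Sum.elim (fun k => (k : ℕ)) (fun k => 2 * n - k)

theorem flagPos_injective : Function.Injective (flagPos (n := n)) := by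
  rintro (k | k) (l | l) h <;> simp only [flagPos, Sum.elim_inl, Sum.elim_inr] at h
  · exact congrArg _ (Fin.ext h)
  · omega
  · omega
  · exact congrArg _ (Fin.ext (by omega))

/-- The flag order is self-dual: exchanging each `u_k` with `v_k` reverses it. Hence the two
off-diagonal entries of a short root element lie on the same side of the diagonal. -/
theorem flagPos_swap_lt {P Q : Fin n ⊕ Fin n} (h : flagPos P < flagPos Q) :
    flagPos Q.swap < flagPos P.swap := by
  rcases P with k | k <;> rcases Q with l | l <;>
    simp only [flagPos, Sum.elim_inl, Sum.elim_inr, Sum.swap_inl, Sum.swap_inr] at h ⊢ <;> omega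

/-- The elements of `Sp` which preserve `span {u_1, …, u_n}` and act on it by an upper
unitriangular matrix. -/
def unipotentShape (n : ℕ) (K : Type*) [Field K] : Submonoid (Sp n K) where
  carrier := {g | (∀ k l, mat g (.inr k) (.inl l) = 0) ∧
    (∀ k l, l < k → mat g (.inl k) (.inl l) = 0) ∧ ∀ k, mat g (.inl k) (.inl k) = 1}
  one_mem' := by
    refine ⟨fun k l => ?_, fun k l h => ?_, fun k => ?_⟩
    · simp [mat]
    · simp [mat, h.ne']
    · simp [mat]
  mul_mem' {g g'} hg hg' := by
    obtain ⟨h1, h2, h3⟩ := hg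
    obtain ⟨h1', h2', h3'⟩ := hg'
    refine ⟨fun k l => ?_, fun k l h => ?_, fun k => ?_⟩ <;>
      rw [mat_mul, Matrix.mul_apply, Fintype.sum_sum_type]
    · simp [h1, h1']
    · simp only [h1', mul_zero, Finset.sum_const_zero, add_zero]
      refine Finset.sum_eq_zero fun m _ => ?_
      rcases lt_or_ge m k with hm | hm
      · rw [h2 k m hm, zero_mul]
      · rw [h2' m l (h.trans_le hm), mul_zero]
    · simp only [h1', mul_zero, Finset.sum_const_zero, add_zero]
      rw [Finset.sum_eq_single k, h3, h3', one_mul]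
      · intro m _ hm
        rcases lt_or_gt_of_ne hm with hm | hm
        · rw [h2 k m hm, zero_mul]
        · rw [h2' m k hm, mul_zero]
      · simp

theorem mem_unipotentShape {g : Sp n K} : g ∈ unipotentShape n K ↔
    (∀ k l, mat g (.inr k) (.inl l) = 0) ∧
    (∀ k l, l < k → mat g (.inl k) (.inl l) = 0) ∧ ∀ k, mat g (.inl k) (.inl k) = 1 :=
  Iff.rfl

theorem mulVec_uVec (g : Sp n K) (l : Fin n) : mat g *ᵥ uVec l = fun P => mat g P (.inl l) := by
  ext P
  simp [uVec]

/-- A matrix preserving `span {u_1, …, u_n}` which acts on it by `A ∈ GL_n` lies in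
`diag(A, ᵗA⁻¹) Sp^M`. -/
theorem inv_levi_mul_mem_SpM {g : Sp n K} (A : GL (Fin n) K)
    (h0 : ∀ k l, mat g (.inr k) (.inl l) = 0) (hA : ∀ k l, mat g (.inl k) (.inl l) = A k l) :
    (levi A)⁻¹ * g ∈ SpM n K := by
  intro l
  have h1 : mat g *ᵥ uVec l = mat (levi A) *ᵥ uVec l := by
    rw [mulVec_uVec, mulVec_uVec]
    ext (k | k)
    · exact hA k l
    · exact h0 k l
  have h2 : mat (levi A)⁻¹ * mat (levi A) = 1 := congrArg Subtype.val (inv_mul_cancel (levi A))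
  rw [mat_mul, ← Matrix.mulVec_mulVec, h1, Matrix.mulVec_mulVec, h2, Matrix.one_mulVec]

theorem mem_U_of_mem_unipotentShape {g : Sp n K} (hg : g ∈ unipotentShape n K) : g ∈ U n K := by
  obtain ⟨h1, h2, h3⟩ := hg
  let A₀ : Matrix (Fin n) (Fin n) K := fun k l => mat g (.inl k) (.inl l)
  have hdet : A₀.det = 1 := by
    rw [Matrix.det_of_isUpperTriangular (fun k l h => h2 k l h)]
    exact Finset.prod_eq_one fun k _ => h3 k
  let A : GL (Fin n) K := Matrix.GeneralLinearGroup.mk'' A₀ (by rw [hdet]; exact isUnit_one)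
  have hA : ∀ k l, A k l = mat g (.inl k) (.inl l) := fun k l => rfl
  have : g = levi A * ((levi A)⁻¹ * g) := by group
  rw [this]
  refine mul_mem (Subgroup.mem_sup_left ⟨A, ⟨fun k l h => ?_, fun k => ?_⟩, rfl⟩)
    (Subgroup.mem_sup_right (inv_levi_mul_mem_SpM A h1 fun k l => (hA k l).symm))
  · exact h2 k l h
  · exact h3 k

/-- Triangularity is only shown to be closed under products; finiteness supplies inverses, since an
inverse is then a positive power. -/
theorem mem_U_iff [Finite K] {g : Sp n K} : g ∈ U n K ↔ g ∈ unipotentShape n K := by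
  refine ⟨fun hg => ?_, mem_U_of_mem_unipotentShape⟩
  rw [U, Subgroup.sup_eq_closure] at hg
  induction hg using Subgroup.closure_induction with
  | mem g hg =>
    rcases hg with ⟨A, hA, rfl⟩ | hg
    · exact ⟨fun k l => rfl, hA.1, hA.2⟩
    · have h : ∀ P l, mat g P (.inl l) = uVec l P := fun P l => by
        rw [← hg l, mulVec_uVec]
      refine ⟨fun k l => ?_, fun k l hl => ?_, fun k => ?_⟩ <;> rw [h]
      · simp [uVec]
      · simp [uVec, Pi.single_apply, hl.ne']
      · simp [uVec]
  | one => exact one_mem _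
  | mul g g' _ _ hg hg' => exact mul_mem hg hg'
  | inv g _ hg =>
    have h : g⁻¹ ∈ Submonoid.powers g := by
      rw [← SetLike.mem_coe, powers_eq_zpowers]
      exact inv_mem (Subgroup.mem_zpowers g)
    exact (Submonoid.powers_le.2 hg) h

/-- The symplectic relations make the upper left block invertible, so its diagonal is nonzero and
can be normalized to `1` by an element of `H`. Nothing need be checked on the remaining blocks. -/
theorem mem_B_of_triangular {g : Sp n K} (h1 : ∀ k l, mat g (.inr k) (.inl l) = 0)
    (h2 : ∀ k l, l < k → mat g (.inl k) (.inl l) = 0) : g ∈ B n K := by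
  let A₀ : Matrix (Fin n) (Fin n) K := fun k l => mat g (.inl k) (.inl l)
  have hmul : A₀ * Matrix.of (fun k l => mat g (.inr l) (.inr k)) = 1 := by
    ext k l
    rw [Matrix.mul_apply, one_apply, ← row_inl_inr g k l]
    simp [h1, A₀]
  have hdet : A₀.det ≠ 0 := fun h => by
    have := congrArg Matrix.det hmul
    rw [Matrix.det_mul, h, zero_mul, Matrix.det_one] at this
    exact zero_ne_one this
  rw [Matrix.det_of_isUpperTriangular (fun k l h => h2 k l h), Finset.prod_ne_zero_iff] at hdet
  have hd : ∀ k, mat g (.inl k) (.inl k) ≠ 0 := fun k => hdet k (Finset.mem_univ k)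
  let D : GL (Fin n) K :=
    ⟨diagonal fun k => (mat g (.inl k) (.inl k))⁻¹, diagonal fun k => mat g (.inl k) (.inl k),
      by simp [Matrix.diagonal_mul_diagonal, hd], by simp [Matrix.diagonal_mul_diagonal, hd]⟩
  have hD : mat (levi D) = fromBlocks (diagonal fun k => (mat g (.inl k) (.inl k))⁻¹) 0 0
      (diagonal fun k => mat g (.inl k) (.inl k))ᵀ := rfl
  have hDH : levi D ∈ H n K := by
    change (mat (levi D)).IsDiag
    rw [hD, Matrix.diagonal_transpose, Matrix.fromBlocks_diagonal]
    exact Matrix.isDiag_diagonal _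
  have hcol : ∀ P l, mat (g * levi D) P (.inl l) =
      mat g P (.inl l) * (mat g (.inl l) (.inl l))⁻¹ := fun P l => by
    rw [mat_mul, Matrix.mul_apply, Fintype.sum_sum_type, hD]
    simp [diagonal_apply]
  have : g = g * levi D * (levi D)⁻¹ := by group
  rw [this]
  refine mul_mem (Subgroup.mem_sup_left (mem_U_of_mem_unipotentShape
    ⟨fun k l => ?_, fun k l h => ?_, fun k => ?_⟩)) (Subgroup.mem_sup_right (inv_mem hDH))
  · rw [hcol, h1, zero_mul]
  · rw [hcol, h2 k l h, zero_mul]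
  · rw [hcol, mul_inv_cancel₀ (hd k)]

/-- `g` is a monomial matrix with underlying permutation `σ`, which respects the pairs
`{u_i, v_i}`. -/
def IsMonomial (g : Sp n K) (σ : Equiv.Perm (Fin n ⊕ Fin n)) : Prop :=
  (∀ P, σ P.swap = (σ P).swap) ∧ ∃ d : Fin n ⊕ Fin n → K, (∀ P, d P ≠ 0) ∧
    ∀ P Q, mat g P Q = if Q = σ P then d P else 0

theorem IsMonomial.ne_zero_iff {g : Sp n K} {σ : Equiv.Perm (Fin n ⊕ Fin n)}
    (h : IsMonomial g σ) (P Q : Fin n ⊕ Fin n) : mat g P Q ≠ 0 ↔ Q = σ P := by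
  obtain ⟨-, d, hd, hg⟩ := h
  rw [hg]
  split_ifs with hQ <;> simp [hQ, hd]

/-- The monomial matrices in `Sp` respecting the pairs `{u_i, v_i}`. -/
def monomialGroup (n : ℕ) (K : Type*) [Field K] : Subgroup (Sp n K) where
  carrier := {g | ∃ σ, IsMonomial g σ}
  one_mem' := ⟨1, fun P => rfl, fun _ => 1, by simp, fun P Q => by
    simp [mat, one_apply, eq_comm]⟩
  mul_mem' := by
    rintro g g' ⟨σ, hσ, d, hd, hg⟩ ⟨σ', hσ', d', hd', hg'⟩
    refine ⟨σ.trans σ', fun P => by simp [hσ, hσ'], fun P => d P * d' (σ P),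
      fun P => mul_ne_zero (hd _) (hd' _), fun P Q => ?_⟩
    rw [mat_mul, Matrix.mul_apply]
    rw [Finset.sum_eq_single (σ P)]
    · by_cases hQ : Q = σ' (σ P) <;> simp [hg, hg', hQ]
    · intro R _ hR
      rw [hg, if_neg hR, zero_mul]
    · simp
  inv_mem' := by
    rintro g ⟨σ, hσ, d, hd, hg⟩
    have hN : mat g * (Matrix.of fun P Q => if Q = σ.symm P then (d (σ.symm P))⁻¹ else 0) = 1 := by
      ext P Q
      rw [Matrix.mul_apply]
      rw [Finset.sum_eq_single (σ P)]
      · by_cases hPQ : P = Q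
        · simp [hg, one_apply, hPQ, hd]
        · simp [hg, one_apply, hPQ, Ne.symm hPQ]
      · intro R _ hR
        rw [hg, if_neg hR, zero_mul]
      · simp
    have hinv : mat g⁻¹ * mat g = 1 := congrArg Subtype.val (inv_mul_cancel g)
    refine ⟨σ.symm, fun P => ?_, fun P => (d (σ.symm P))⁻¹, fun P => inv_ne_zero (hd _),
      fun P Q => ?_⟩
    · rw [Equiv.symm_apply_eq, hσ, Equiv.apply_symm_apply]
    · rw [left_inv_eq_right_inv hinv hN, Matrix.of_apply]

theorem w_mem_monomialGroup (i j : Fin n) : (w i j : Sp n K) ∈ monomialGroup n K := by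
  refine ⟨Equiv.sumCongr (Equiv.swap i j) (Equiv.swap i j), ?_, fun _ => 1, by simp,
    fun P Q => ?_⟩
  · rintro (k | k) <;> rfl
  · rw [← mul_one (w i j), w_mul_apply]
    rcases P with k | k <;> simp [mat, one_apply, eq_comm]

theorem c_mem_monomialGroup (j : Fin n) : (c j : Sp n K) ∈ monomialGroup n K := by
  refine ⟨Equiv.swap (.inl j) (.inr j), ?_, fun P => if P = .inl j then -1 else 1, ?_,
    fun P Q => ?_⟩
  · rintro (k | k) <;> by_cases hk : k = j <;> simp [hk, Equiv.swap_apply_def]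
  · intro P
    dsimp only
    split_ifs <;> simp
  · rcases P with k | k <;> rcases Q with l | l <;>
      simp only [mat_c, fromBlocks_apply₁₁, fromBlocks_apply₁₂, fromBlocks_apply₂₁,
        fromBlocks_apply₂₂, Matrix.sub_apply, Matrix.neg_apply, one_apply, single_apply,
        Equiv.swap_apply_def] <;> grind

theorem W₂_le_monomialGroup : W₂ n K ≤ monomialGroup n K := by
  refine sup_le ((Subgroup.closure_le _).2 ?_) ((Subgroup.closure_le _).2 ?_)
  · rintro _ ⟨j, rfl⟩
    exact c_mem_monomialGroup j
  · rintro _ ⟨i, j, -, rfl⟩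
    exact w_mem_monomialGroup i j

/-- Conjugating by a monomial matrix permutes the entries of a matrix; if the result is
triangular for the flag order, it lies in `B`. -/
theorem IsMonomial.conj_mem_B {g M : Sp n K} {σ : Equiv.Perm (Fin n ⊕ Fin n)}
    (hg : IsMonomial g σ) (hM : ∀ P Q, mat M P Q ≠ 0 → flagPos (σ P) ≤ flagPos (σ Q)) :
    g⁻¹ * M * g ∈ B n K := by
  obtain ⟨-, d, hd, hg⟩ := hg
  have hgN : g * (g⁻¹ * M * g) = M * g := by group
  have hN : ∀ P Q, flagPos Q < flagPos P → mat (g⁻¹ * M * g) P Q = 0 := by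
    intro P Q hlt
    obtain ⟨P, rfl⟩ := σ.surjective P
    obtain ⟨Q, rfl⟩ := σ.surjective Q
    -- Entry `(P, σ Q)` of `g N = M g`, where `N` is the conjugate: it says that `N (σ P) (σ Q)` is
    -- `M P Q` up to nonzero scalars.
    have h := congrFun (congrFun (congrArg mat hgN) P) (σ Q)
    rw [mat_mul g, mat_mul M, Matrix.mul_apply, Matrix.mul_apply] at h
    simp only [hg, ite_mul, zero_mul, mul_ite, mul_zero, EmbeddingLike.apply_eq_iff_eq,
      Finset.sum_ite_eq, Finset.sum_ite_eq', Finset.mem_univ, if_true] at h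
    have hz : mat M P Q = 0 := by
      by_contra hne
      exact absurd (hM P Q hne) (not_le.2 hlt)
    rw [hz, zero_mul] at h
    exact (mul_eq_zero.1 h).resolve_left (hd P)
  refine mem_B_of_triangular (fun k l => hN _ _ ?_) (fun k l h => hN _ _ ?_)
  · simp only [flagPos, Sum.elim_inl, Sum.elim_inr]
    omega
  · exact h

end Shapes

/-! ### Rank one relation and action of a simple reflection on coefficients -/

section Abstract

variable {G R : Type*} [Group G] [Ring R] (ρ : G →* R)

/-- The rank one relation `s x e = y e + e` in characteristic two, for `e = z + s z`. -/
theorem rank_one_relation [CharP R 2] {s a y : G} {e z : R} (he : e = z + ρ s * z)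
    (hss : ρ (s * s) * z = z) (hx : ρ a * z = z) (hy : ρ y * z = z)
    (h : ρ (s * y⁻¹ * s * a * s) * z = z) : ρ (s * a) * e = ρ y * e + e := by
  have h1 : ρ (s * a * s) * z = ρ y * (ρ s * z) := by
    -- Both elements fix `z`; multiplying by `y s⁻¹` leaves `s a s z = y s z`.
    have h2 : ρ (s * y⁻¹ * s * a * s) * z = ρ (s * s) * z := by rw [h, hss]
    have h3 := congrArg (fun t => ρ (y * s⁻¹) * t) h2
    simp only [← mul_assoc, ← map_mul] at h3
    rw [← mul_assoc, ← map_mul]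
    convert h3 using 3 <;> group
  have h2 : ρ (s * a) * (ρ s * z) = ρ y * (ρ s * z) := by
    rw [← h1, ← mul_assoc, ← map_mul]
  have h3 : ρ (s * a) * z = ρ s * z := by
    rw [map_mul, mul_assoc, hx]
  rw [he, mul_add, mul_add, h2, h3, hy]
  have h4 : z + z = 0 := CharTwo.add_self_eq_zero z
  calc ρ s * z + ρ y * (ρ s * z) = (z + z) + ρ y * (ρ s * z) + ρ s * z := by
        rw [h4]; abel
    _ = _ := by abel

variable {F K : Type*} [Field F] [Algebra F R] [Field K] [Fintype K]

/-- A function on a group `N = V X`, where `V` is the zero set of `ent` and `X` is a one-parameter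
group on which `ent` is the identity, is summed first over `V` and then over `X`. -/
theorem sum_eq_sum_sum_mul_oneParam {A : Type*} [AddCommMonoid A] [Fintype G] [DecidableEq K]
    (N : Subgroup G) [DecidablePred (· ∈ N)] (a : K → G) (ent : G → K) (haN : ∀ t, a t ∈ N)
    (ha0 : a 0 = 1) (ha : ∀ t t', a t * a t' = a (t + t'))
    (hent : ∀ u ∈ N, ∀ t, ent (u * a t) = ent u + t) (f : G → A) :
    ∑ u with u ∈ N, f u = ∑ v with v ∈ N ∧ ent v = 0, ∑ t, f (v * a t) := by
  rw [← Finset.sum_product']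
  refine Finset.sum_nbij' (fun u => (u * a (-ent u), ent u)) (fun q => q.1 * a q.2) ?_ ?_ ?_ ?_ ?_
  · intro u hu
    simp only [Finset.mem_filter, Finset.mem_univ, true_and] at hu
    simp [mul_mem hu (haN _), hent u hu]
  · rintro ⟨v, t⟩ hv
    simp only [Finset.mem_product, Finset.mem_filter, Finset.mem_univ, true_and, and_true] at hv
    simp [mul_mem hv.1 (haN _)]
  · intro u hu
    simp [mul_assoc, ha, ha0]
  · rintro ⟨v, t⟩ hv
    simp only [Finset.mem_product, Finset.mem_filter, Finset.mem_univ, true_and, and_true] at hv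
    simp [hent v hv.1, hv.2, mul_assoc, ha, ha0]
  · intro u hu
    simp [mul_assoc, ha, ha0]

open Classical in
/-- The action of a simple reflection `s` on the coefficients of an element `∑ f(u) u e` of a
Steinberg module in characteristic two. -/
noncomputable def reflectCoeff (s : G) (a : K → G) (ent : G → K) (κ : K) (f : G → F) (u : G) : F :=
  if ent u = 0 then ∑ t, f (s⁻¹ * u * s * a t)
  else f (s⁻¹ * (u * a (-ent u)) * s * a (κ * (ent u)⁻¹))

/-- On a coset `v X` of the root group, the rank one relation sends the term at `t ≠ 0` to the term
at `κ t⁻¹` plus one copy of the base term. The base point therefore collects the sum over the whole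
coset, and the other coefficients are permuted by `t ↦ κ t⁻¹`. -/
theorem reflect_sum [Fintype G] (N : Subgroup G) [DecidablePred (· ∈ N)] (s : G) (a : K → G)
    (ent : G → K) (haN : ∀ t, a t ∈ N) (ha0 : a 0 = 1) (ha : ∀ t t', a t * a t' = a (t + t'))
    (hent : ∀ u ∈ N, ∀ t, ent (u * a t) = ent u + t)
    (hconj : ∀ v, (v ∈ N ∧ ent v = 0) ↔ (s * v * s⁻¹ ∈ N ∧ ent (s * v * s⁻¹) = 0))
    {κ : K} (hκ : κ * κ = 1) {e : R} (hs : ρ s * e = e)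
    (hrel : ∀ t, t ≠ 0 → ρ (s * a t) * e = ρ (a (κ * t⁻¹)) * e + e) (f : G → F) :
    ρ s * ∑ u with u ∈ N, f u • (ρ u * e) =
      ∑ u with u ∈ N, reflectCoeff s a ent κ f u • (ρ u * e) := by
  classical
  have hκ0 : κ ≠ 0 := fun h => by simp [h] at hκ
  rw [sum_eq_sum_sum_mul_oneParam N a ent haN ha0 ha hent,
    sum_eq_sum_sum_mul_oneParam N a ent haN ha0 ha hent, Finset.mul_sum]
  refine Finset.sum_nbij' (fun v => s * v * s⁻¹) (fun v => s⁻¹ * v * s) ?_ ?_ ?_ ?_ ?_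
  · intro v hv
    simpa using (hconj v).1 (by simpa using hv)
  · intro v hv
    have : v = s * (s⁻¹ * v * s) * s⁻¹ := by group
    rw [Finset.mem_filter, this] at hv
    simpa using (hconj _).2 hv.2
  · intro v _
    group
  · intro v _
    group
  intro v hv
  have hv' := (hconj v).1 (by simpa using hv)
  have hsv : ∀ t, ρ s * (ρ (v * a t) * e) = ρ (s * v * s⁻¹) * (ρ (s * a t) * e) := fun t => by
    rw [← mul_assoc, ← mul_assoc, ← map_mul, ← map_mul]
    congr 2
    group
  have hcoef : ∀ t, reflectCoeff s a ent κ f (s * v * s⁻¹ * a t) =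
      if t = 0 then ∑ t', f (v * a t') else f (v * a (κ * t⁻¹)) := fun t => by
    rw [reflectCoeff, hent _ hv'.1, hv'.2, zero_add]
    split_ifs with ht
    · refine Finset.sum_congr rfl fun t' _ => congrArg f ?_
      rw [ht, ha0]
      group
    · refine congrArg f ?_
      rw [mul_assoc _ (a t), ha, add_neg_cancel, ha0]
      group
  have hsplit : ∀ h : K → R, ∑ t, h t = h 0 + ∑ t with t ≠ 0, h t := fun h => by
    rw [Finset.filter_ne' Finset.univ (0 : K), Finset.add_sum_erase _ _ (Finset.mem_univ _)]
  have hrein : ∑ t with t ≠ (0 : K), f (v * a t) • (ρ (a (κ * t⁻¹)) * e) =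
      ∑ t with t ≠ (0 : K), f (v * a (κ * t⁻¹)) • (ρ (a t) * e) := by
    refine Finset.sum_nbij' (fun t => κ * t⁻¹) (fun t => κ * t⁻¹) ?_ ?_ ?_ ?_ ?_
    · intro t ht
      simp only [Finset.mem_filter, Finset.mem_univ, true_and] at ht ⊢
      exact mul_ne_zero hκ0 (inv_ne_zero ht)
    · intro t ht
      simp only [Finset.mem_filter, Finset.mem_univ, true_and] at ht ⊢
      exact mul_ne_zero hκ0 (inv_ne_zero ht)
    · intro t _
      rw [mul_inv, inv_inv, ← mul_assoc, mul_inv_cancel₀ hκ0, one_mul]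
    · intro t _
      rw [mul_inv, inv_inv, ← mul_assoc, mul_inv_cancel₀ hκ0, one_mul]
    · intro t _
      rw [mul_inv, inv_inv, ← mul_assoc, mul_inv_cancel₀ hκ0, one_mul]
  have hleft : ∑ t with t ≠ (0 : K), f (v * a t) • (ρ (s * a t) * e) =
      ∑ t with t ≠ (0 : K), f (v * a t) • (ρ (a (κ * t⁻¹)) * e) +
        (∑ t with t ≠ (0 : K), f (v * a t)) • e := by
    rw [Finset.sum_smul, ← Finset.sum_add_distrib]
    refine Finset.sum_congr rfl fun t ht => ?_
    rw [hrel t (Finset.mem_filter.1 ht).2, smul_add]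
  have hright : ∑ t with t ≠ (0 : K), (if t = 0 then ∑ t', f (v * a t') else
      f (v * a (κ * t⁻¹))) • (ρ (a t) * e) =
      ∑ t with t ≠ (0 : K), f (v * a (κ * t⁻¹)) • (ρ (a t) * e) :=
    Finset.sum_congr rfl fun t ht => by rw [if_neg (Finset.mem_filter.1 ht).2]
  have htot : ∑ t, f (v * a t) = f (v * a 0) + ∑ t with t ≠ (0 : K), f (v * a t) := by
    rw [Finset.filter_ne' Finset.univ (0 : K),
      Finset.add_sum_erase _ (fun t => f (v * a t)) (Finset.mem_univ _)]
  have hfib : ∑ t, f (v * a t) • (ρ (s * a t) * e) =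
      ∑ t, (if t = 0 then ∑ t', f (v * a t') else f (v * a (κ * t⁻¹))) • (ρ (a t) * e) := by
    rw [hsplit, hsplit (fun t => (if t = 0 then _ else _) • (ρ (a t) * e)), hleft, hright, hrein,
      if_pos rfl, htot, ha0, mul_one, mul_one, hs, map_one, one_mul, add_smul]
    abel
  calc ρ s * ∑ t, f (v * a t) • (ρ (v * a t) * e)
      = ∑ t, f (v * a t) • (ρ s * (ρ (v * a t) * e)) := by
        rw [Finset.mul_sum]
        exact Finset.sum_congr rfl fun t _ => mul_smul_comm _ _ _
    _ = ρ (s * v * s⁻¹) * ∑ t, f (v * a t) • (ρ (s * a t) * e) := by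
        rw [Finset.mul_sum]
        exact Finset.sum_congr rfl fun t _ => by rw [hsv, mul_smul_comm]
    _ = _ := by
        rw [hfib, Finset.mul_sum]
        refine Finset.sum_congr rfl fun t _ => ?_
        rw [mul_smul_comm, hcoef, map_mul ρ _ (a t), mul_assoc (ρ _)]

end Abstract

/-! ### Character sums -/

section Gauss

variable {K F : Type*} [Field K] [Fintype K] [Field F]

/-- Quadratic Gauss sums are trivial in characteristic two. -/
theorem sum_even_function [CharP F 2] (h2 : (2 : K) ≠ 0) (f : K → F) (hf : ∀ t, f (-t) = f t) :
    ∑ t, f t = f 0 := by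
  classical
  rw [← Finset.add_sum_erase Finset.univ f (Finset.mem_univ 0)]
  have : ∑ t ∈ Finset.univ.erase (0 : K), f t = 0 := by
    refine Finset.sum_involution (fun t _ => -t) ?_ ?_ ?_ ?_
    · intro t _
      rw [hf, CharTwo.add_self_eq_zero]
    · intro t ht _ h
      refine (Finset.mem_erase.1 ht).1 ?_
      have : 2 * t = 0 := by linear_combination -h
      exact (mul_eq_zero.1 this).resolve_left h2
    · intro t ht
      simpa using ht
    · intro t _
      simp
  rw [this, add_zero]

theorem sum_addChar_mul (lam : AddChar K F) (hlam : lam ≠ 1) {t : K} (ht : t ≠ 0) :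
    ∑ a, lam (a * t) = 0 := by
  have h : ∑ a, lam (a * t) = ∑ a, lam a :=
    Fintype.sum_equiv (Equiv.mulRight₀ t ht) _ _ fun a => rfl
  rw [h]
  exact AddChar.sum_eq_zero_of_ne_one hlam

end Gauss

/-! ### The apartment, its half-apartments, and the relations satisfied by `e` -/

section Steinberg

variable {n : ℕ} {K : Type*} [Field K] {F : Type*} [Field F]

theorem of_mul_sum_B [Finite K] {b : Sp n K} (hb : b ∈ B n K) :
    MonoidAlgebra.of F (Sp n K) b * ∑ b' : B n K, MonoidAlgebra.of F (Sp n K) b' =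
      ∑ b' : B n K, MonoidAlgebra.of F (Sp n K) b' := by
  rw [Finset.mul_sum]
  refine Fintype.sum_equiv (Equiv.mulLeft (⟨b, hb⟩ : B n K)) _ _ fun b' => ?_
  rw [← map_mul]
  rfl

/-- The image of `n_w` in the permutation module on the cosets of `B`. -/
noncomputable def chamber [Finite K] (F : Type*) [Field F] (r : Weyl n K → W₂ n K) (y : Weyl n K) :
    MonoidAlgebra F (Sp n K) :=
  MonoidAlgebra.of F (Sp n K) (r y) * ∑ b : B n K, MonoidAlgebra.of F (Sp n K) b

variable {r : Weyl n K → W₂ n K}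

theorem steinbergElt_eq_sum_chamber [Finite K] [CharP F 2] :
    steinbergElt F r = ∑ y, chamber F r y := by
  rw [steinbergElt, Finset.sum_mul]
  refine Finset.sum_congr rfl fun y _ => ?_
  rw [CharTwo.neg_eq, one_pow, one_smul, chamber]

/-- `W_2` acts on `W` by left multiplication. -/
instance : MulAction (W₂ n K) (Weyl n K) :=
  have := MulAction.left_quotientAction ((H n K).subgroupOf (W₂ n K))
  MulAction.quotient (W₂ n K) ((H n K).subgroupOf (W₂ n K))

theorem inv_mul_mem_H {g g' : W₂ n K}
    (h : (QuotientGroup.mk g : Weyl n K) = QuotientGroup.mk g') :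
    (g : Sp n K)⁻¹ * g' ∈ H n K :=
  Subgroup.mem_subgroupOf.1 (QuotientGroup.eq.1 h)

theorem of_mul_chamber [Finite K] (hr : ∀ y, (QuotientGroup.mk (r y) : Weyl n K) = y) (g : W₂ n K)
    (y : Weyl n K) :
    MonoidAlgebra.of F (Sp n K) g * chamber F r y = chamber F r (g • y) := by
  have h : (QuotientGroup.mk (r (g • y)) : Weyl n K) = QuotientGroup.mk (g * r y) := by
    rw [hr]
    conv_lhs => rw [← hr y]
    rfl
  have hb := inv_mul_mem_H h
  conv_rhs => rw [chamber, ← of_mul_sum_B (Subgroup.mem_sup_right hb : _ ∈ B n K), ← mul_assoc,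
    ← map_mul, mul_inv_cancel_left]
  rw [chamber, ← mul_assoc, ← map_mul]
  rfl

/-- Left multiplication permutes the chambers of the apartment, and no sign survives in
characteristic two. -/
theorem of_mul_steinbergElt [Finite K] [CharP F 2] (hr : ∀ y, (QuotientGroup.mk (r y) : Weyl n K) = y)
    {g : Sp n K} (hg : g ∈ W₂ n K) :
    MonoidAlgebra.of F (Sp n K) g * steinbergElt F r = steinbergElt F r := by
  rw [steinbergElt_eq_sum_chamber, Finset.mul_sum]
  exact Fintype.sum_equiv (MulAction.toPerm (⟨g, hg⟩ : W₂ n K)) _ _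
    fun y => of_mul_chamber hr ⟨g, hg⟩ y

/-- For monomial `g`: the basis vector `g⁻¹ P` precedes `g⁻¹ Q` in the flag order. -/
def Precedes (g : Sp n K) (P Q : Fin n ⊕ Fin n) : Prop :=
  ∃ P' Q', mat g P P' ≠ 0 ∧ mat g Q Q' ≠ 0 ∧ flagPos P' < flagPos Q'

theorem IsMonomial.precedes_iff {g : Sp n K} {σ : Equiv.Perm (Fin n ⊕ Fin n)}
    (h : IsMonomial g σ) (P Q : Fin n ⊕ Fin n) :
    Precedes g P Q ↔ flagPos (σ P) < flagPos (σ Q) := by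
  constructor
  · rintro ⟨P', Q', hP, hQ, hlt⟩
    rw [h.ne_zero_iff] at hP hQ
    rwa [hP, hQ] at hlt
  · exact fun hlt => ⟨_, _, (h.ne_zero_iff _ _).2 rfl, (h.ne_zero_iff _ _).2 rfl, hlt⟩

/-- Right multiplication by a diagonal matrix does not move the nonzero entries, so the side of a
wall depends only on the class in `W`. -/
theorem precedes_of_inv_mul_mem_H {g g' : Sp n K} (h : g⁻¹ * g' ∈ H n K)
    {P Q : Fin n ⊕ Fin n} (hg : Precedes g' P Q) : Precedes g P Q := by
  have key : ∀ A A', mat g' A A' ≠ 0 → mat g A A' ≠ 0 := by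
    intro A A' hne h0
    refine hne ?_
    have : g' = g * (g⁻¹ * g') := by group
    rw [this, mat_mul, Matrix.mul_apply]
    refine Finset.sum_eq_zero fun C _ => ?_
    by_cases hC : C = A'
    · rw [hC, h0, zero_mul]
    · rw [show mat (g⁻¹ * g') C A' = 0 from h hC, mul_zero]
  obtain ⟨P', Q', hP, hQ, hlt⟩ := hg
  exact ⟨P', Q', key _ _ hP, key _ _ hQ, hlt⟩

/-- The half `z` of the apartment on the positive side of a wall: `e = z + s z`, and `z` is fixed
by the elements of `Sp` whose only off-diagonal entries are those of the positive root. -/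
theorem exists_half_apartment [Finite K] [CharP F 2]
    (hr : ∀ y, (QuotientGroup.mk (r y) : Weyl n K) = y) {s : Sp n K} (hs : s ∈ W₂ n K)
    {P Q : Fin n ⊕ Fin n} (hPQ : P ≠ Q)
    (hP : ∀ (g : Sp n K) A, mat (s * g) P A ≠ 0 ↔ mat g Q A ≠ 0)
    (hQ : ∀ (g : Sp n K) A, mat (s * g) Q A ≠ 0 ↔ mat g P A ≠ 0) :
    ∃ z : MonoidAlgebra F (Sp n K),
      steinbergElt F r = z + MonoidAlgebra.of F (Sp n K) s * z ∧
      ∀ M : Sp n K, (∀ A C, mat M A C ≠ 0 →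
        A = C ∨ (A = P ∧ C = Q) ∨ (A = Q.swap ∧ C = P.swap)) →
        MonoidAlgebra.of F (Sp n K) M * z = z := by
  classical
  let D : Weyl n K → Prop := fun y => Precedes (r y : Sp n K) P Q
  -- `s` exchanges the rows `P` and `Q` up to scalars, hence the two sides of the wall.
  have hD : ∀ y, ¬ D ((⟨s, hs⟩ : W₂ n K) • y) ↔ D y := by
    intro y
    have h : (QuotientGroup.mk (r ((⟨s, hs⟩ : W₂ n K) • y)) : Weyl n K) =
        QuotientGroup.mk (⟨s, hs⟩ * r y) := by
      rw [hr]
      conv_lhs => rw [← hr y]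
      rfl
    have h1 : D ((⟨s, hs⟩ : W₂ n K) • y) ↔ Precedes (s * (r y : Sp n K)) P Q :=
      ⟨fun h' => precedes_of_inv_mul_mem_H (inv_mul_mem_H h.symm) h',
        fun h' => precedes_of_inv_mul_mem_H (inv_mul_mem_H h) h'⟩
    have h2 : Precedes (s * (r y : Sp n K)) P Q ↔ Precedes (r y : Sp n K) Q P := by
      simp only [Precedes, hP, hQ]
    obtain ⟨σ, hσ⟩ := W₂_le_monomialGroup (r y).2
    rw [h1, h2, hσ.precedes_iff, show D y ↔ _ from hσ.precedes_iff P Q, not_lt]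
    have hne : flagPos (σ P) ≠ flagPos (σ Q) := fun h' =>
      hPQ (σ.injective (flagPos_injective h'))
    exact ⟨fun h' => lt_of_le_of_ne h' hne, le_of_lt⟩
  refine ⟨∑ y with D y, chamber F r y, ?_, fun M hM => ?_⟩
  · rw [steinbergElt_eq_sum_chamber, ← Finset.sum_filter_add_sum_filter_not _ D]
    congr 1
    rw [Finset.mul_sum, Finset.sum_filter, Finset.sum_filter]
    symm
    refine Fintype.sum_equiv (MulAction.toPerm (⟨s, hs⟩ : W₂ n K)) _ _ fun y => ?_
    simp only [MulAction.toPerm_apply, hD]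
    rw [← of_mul_chamber hr]
  · rw [Finset.mul_sum]
    refine Finset.sum_congr rfl fun y hy => ?_
    obtain ⟨σ, hσ⟩ := W₂_le_monomialGroup (r y).2
    have hlt := (hσ.precedes_iff P Q).1 (Finset.mem_filter.1 hy).2
    -- `M` fixes the chamber of `r y` once its conjugate lies in `B`. On the positive side `P`
    -- precedes `Q`, and by duality `Q.swap` precedes `P.swap`, so the conjugate is triangular.
    have hmem : (r y : Sp n K)⁻¹ * M * r y ∈ B n K := by
      refine hσ.conj_mem_B fun A C hAC => ?_
      rcases hM A C hAC with rfl | ⟨rfl, rfl⟩ | ⟨rfl, rfl⟩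
      · exact le_rfl
      · exact hlt.le
      · rw [hσ.1, hσ.1]
        exact (flagPos_swap_lt hlt).le
    conv_rhs => rw [chamber, ← of_mul_sum_B hmem, ← mul_assoc, ← map_mul]
    rw [chamber, ← mul_assoc, ← map_mul]
    congr 2
    group

theorem W₂_w_mem {i j : Fin n} (hij : (i : ℕ) + 1 = j) : (w i j : Sp n K) ∈ W₂ n K :=
  Subgroup.mem_sup_right (Subgroup.subset_closure ⟨i, j, hij, rfl⟩)

theorem W₂_c_mem (j : Fin n) : (c j : Sp n K) ∈ W₂ n K :=
  Subgroup.mem_sup_left (Subgroup.subset_closure ⟨j, rfl⟩)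

instance [CharP F 2] : CharP (MonoidAlgebra F (Sp n K)) 2 :=
  charP_of_injective_algebraMap (algebraMap F (MonoidAlgebra F (Sp n K))).injective 2

theorem mat_one_apply (P Q : Fin n ⊕ Fin n) :
    mat (1 : Sp n K) P Q = if P = Q then 1 else 0 := by
  simp [mat, one_apply]

theorem x_apply_ne_zero {i j : Fin n} {h : (i : ℕ) < j} {t : K} {P Q : Fin n ⊕ Fin n}
    (hPQ : mat (x i j h t) P Q ≠ 0) :
    P = Q ∨ (P = .inl i ∧ Q = .inl j) ∨ (P = .inr j ∧ Q = .inr i) := by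
  rw [← mul_one (x i j h t)] at hPQ
  rcases P with k | k
  · rw [x_mul_apply_inl] at hPQ
    by_contra hc
    simp only [not_or, not_and] at hc
    refine hPQ ?_
    by_cases hk : k = i
    · simp [mat_one_apply, hk, Ne.symm (hc.2.1 (congrArg _ hk)), hk ▸ hc.1]
    · simp [mat_one_apply, hk, hc.1]
  · rw [x_mul_apply_inr] at hPQ
    by_contra hc
    simp only [not_or, not_and] at hc
    refine hPQ ?_
    by_cases hk : k = j
    · simp [mat_one_apply, hk, Ne.symm (hc.2.2 (congrArg _ hk)), hk ▸ hc.1]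
    · simp [mat_one_apply, hk, hc.1]

theorem longRoot_apply_ne_zero {j : Fin n} {t : K} {P Q : Fin n ⊕ Fin n}
    (hPQ : mat (longRoot j t) P Q ≠ 0) : P = Q ∨ (P = .inl j ∧ Q = .inr j) := by
  rw [← mul_one (longRoot j t)] at hPQ
  by_contra hc
  simp only [not_or, not_and] at hc
  refine hPQ ?_
  rcases P with k | k
  · rw [longRoot_mul_apply_inl]
    by_cases hk : k = j
    · simp [mat_one_apply, hk, Ne.symm (hc.2 (congrArg _ hk)), hk ▸ hc.1]
    · simp [mat_one_apply, hk, hc.1]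
  · simp [-mul_one, longRoot_mul_apply_inr, mat_one_apply, hc.1]

/-- On `span {u_i, u_j}` the product is the upper triangular matrix with rows `(t, 1)` and `(0,
-t⁻¹)`; on the `v`'s it acts by the inverse transpose. -/
theorem w_x_w_x_w_apply_ne_zero {i j : Fin n} {h : (i : ℕ) < j} {t : K} (ht : t ≠ 0)
    {P Q : Fin n ⊕ Fin n}
    (hPQ : mat (w i j * x i j h (-t⁻¹) * w i j * x i j h t * w i j) P Q ≠ 0) :
    P = Q ∨ (P = .inl i ∧ Q = .inl j) ∨ (P = .inr j ∧ Q = .inr i) := by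
  have hne : i ≠ j := Fin.ne_of_lt h
  by_contra hc
  simp only [not_or, not_and] at hc
  refine hPQ ?_
  clear hPQ
  rw [← mul_one (_ * w i j), mul_assoc, mul_assoc, mul_assoc, mul_assoc, w_mul_apply]
  rcases P with k | k
  · by_cases hi : k = i
    · subst hi
      simp [-mul_one, x_mul_apply_inl, w_mul_apply, mat_one_apply, hne, hne.symm, ht]
      split_ifs <;> simp_all
    · by_cases hj : k = j
      · subst hj
        simp [-mul_one, x_mul_apply_inl, w_mul_apply, mat_one_apply, hne, hne.symm, ht]
        split_ifs <;> simp_all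
      · simp [-mul_one, x_mul_apply_inl, w_mul_apply, mat_one_apply, hne, hne.symm, ht, hi, hj,
          Equiv.swap_apply_of_ne_of_ne]
        exact hc.1
  · by_cases hi : k = i
    · subst hi
      simp [-mul_one, x_mul_apply_inr, w_mul_apply, mat_one_apply, hne, hne.symm, ht]
      split_ifs <;> simp_all
    · by_cases hj : k = j
      · subst hj
        simp [-mul_one, x_mul_apply_inr, w_mul_apply, mat_one_apply, hne, hne.symm, ht]
        split_ifs <;> simp_all
      · simp [-mul_one, x_mul_apply_inr, w_mul_apply, mat_one_apply, hne, hne.symm, ht, hi, hj,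
          Equiv.swap_apply_of_ne_of_ne]
        exact hc.1

/-- On `span {u_j, v_j}` the product is the upper triangular matrix with rows `(-t, 1)` and `(0,
-t⁻¹)`. The sign of `c j * c j` on this plane is why `t⁻¹` replaces the `-t⁻¹` of the short root. -/
theorem c_y_c_y_c_apply_ne_zero {j : Fin n} {t : K} (ht : t ≠ 0) {P Q : Fin n ⊕ Fin n}
    (hPQ : mat (c j * longRoot j t⁻¹ * c j * longRoot j t * c j) P Q ≠ 0) :
    P = Q ∨ (P = .inl j ∧ Q = .inr j) := by
  by_contra hc
  simp only [not_or, not_and] at hc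
  refine hPQ ?_
  clear hPQ
  rw [← mul_one (_ * c j), mul_assoc, mul_assoc, mul_assoc, mul_assoc]
  rcases P with k | k
  · by_cases hj : k = j
    · subst hj
      simp [-mul_one, c_mul_apply_inl, c_mul_apply_inr, longRoot_mul_apply_inl,
        longRoot_mul_apply_inr, mat_one_apply, ht]
      split_ifs <;> simp_all
    · simp [-mul_one, c_mul_apply_inl, c_mul_apply_inr, longRoot_mul_apply_inl,
        longRoot_mul_apply_inr, mat_one_apply, ht, hj]
      exact hc.1
  · by_cases hj : k = j
    · subst hj
      simp [-mul_one, c_mul_apply_inl, c_mul_apply_inr, longRoot_mul_apply_inl,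
        longRoot_mul_apply_inr, mat_one_apply, ht]
      split_ifs <;> simp_all
    · simp [-mul_one, c_mul_apply_inl, c_mul_apply_inr, longRoot_mul_apply_inl,
        longRoot_mul_apply_inr, mat_one_apply, ht, hj]
      exact hc.1

theorem c_c_apply_ne_zero {j : Fin n} {P Q : Fin n ⊕ Fin n}
    (hPQ : mat (c j * c j : Sp n K) P Q ≠ 0) : P = Q := by
  by_contra hc
  refine hPQ ?_
  rw [← mul_one (_ * c j), mul_assoc]
  rcases P with k | k <;> by_cases hj : k = j <;>
    simp [-mul_one, c_mul_apply_inl, c_mul_apply_inr, mat_one_apply, hj, hc] <;> simpa [hj] using hc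

theorem w_mul_x_mul_steinbergElt [Finite K] [CharP F 2]
    (hr : ∀ y, (QuotientGroup.mk (r y) : Weyl n K) = y) {i j : Fin n} (hij : (i : ℕ) + 1 = j)
    (h : (i : ℕ) < j) {t : K} (ht : t ≠ 0) :
    MonoidAlgebra.of F (Sp n K) (w i j * x i j h t) * steinbergElt F r =
      MonoidAlgebra.of F (Sp n K) (x i j h (1 * t⁻¹)) * steinbergElt F r + steinbergElt F r := by
  have hne : i ≠ j := Fin.ne_of_lt h
  obtain ⟨z, he, hz⟩ := exists_half_apartment (F := F) hr (W₂_w_mem hij)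
    (P := .inl i) (Q := .inl j) (by simpa using hne)
    (fun g A => by rw [w_mul_apply]; simp) (fun g A => by rw [w_mul_apply]; simp)
  have hx : ∀ a, MonoidAlgebra.of F (Sp n K) (x i j h a) * z = z :=
    fun a => hz _ fun A C hAC => x_apply_ne_zero hAC
  refine rank_one_relation _ he ?_ (hx _) (hx _) (hz _ fun A C hAC => ?_)
  · rw [w_mul_w, map_one, one_mul]
  · have hinv : (x i j h (1 * t⁻¹))⁻¹ = x i j h (-t⁻¹) :=
      inv_eq_of_mul_eq_one_right (by rw [x_mul_x, one_mul, add_neg_cancel, x_zero])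
    rw [hinv] at hAC
    exact w_x_w_x_w_apply_ne_zero ht hAC

theorem c_mul_longRoot_mul_steinbergElt [Finite K] [CharP F 2]
    (hr : ∀ y, (QuotientGroup.mk (r y) : Weyl n K) = y) (j : Fin n) {t : K} (ht : t ≠ 0) :
    MonoidAlgebra.of F (Sp n K) (c j * longRoot j t) * steinbergElt F r =
      MonoidAlgebra.of F (Sp n K) (longRoot j (-1 * t⁻¹)) * steinbergElt F r +
        steinbergElt F r := by
  obtain ⟨z, he, hz⟩ := exists_half_apartment (F := F) hr (W₂_c_mem j)
    (P := .inl j) (Q := .inr j) (by simp)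
    (fun g A => by rw [c_mul_apply_inl]; simp) (fun g A => by rw [c_mul_apply_inr]; simp)
  have hx : ∀ a, MonoidAlgebra.of F (Sp n K) (longRoot j a) * z = z :=
    fun a => hz _ fun A C hAC => (longRoot_apply_ne_zero hAC).imp_right .inl
  refine rank_one_relation _ he (hz _ fun A C hAC => .inl (c_c_apply_ne_zero hAC)) (hx _) (hx _)
    (hz _ fun A C hAC => ?_)
  have hinv : (longRoot j (-1 * t⁻¹))⁻¹ = longRoot j t⁻¹ :=
    inv_eq_of_mul_eq_one_right (by rw [longRoot_mul_longRoot, neg_one_mul, neg_add_cancel,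
      longRoot_zero])
  rw [hinv] at hAC
  exact (c_y_c_y_c_apply_ne_zero ht hAC).imp_right .inl

end Steinberg

/-! ### Root groups and their complements in `U` for the last two simple roots -/

section LastTwo

variable {n : ℕ} {K : Type*} [Field K]

theorem x_mem_U {i j : Fin n} (h : (i : ℕ) < j) (t : K) : x i j h t ∈ U n K := by
  have hne : i ≠ j := Fin.ne_of_lt h
  refine mem_U_of_mem_unipotentShape ⟨fun k l => ?_, fun k l hl => ?_, fun k => ?_⟩
  · by_contra hc
    rcases x_apply_ne_zero hc with hc | hc | hc <;> simp at hc
  · by_contra hc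
    rcases x_apply_ne_zero hc with hc | hc | hc
    · exact hl.ne' (Sum.inl.inj hc)
    · have h1 := Sum.inl.inj hc.1
      have h2 := Sum.inl.inj hc.2
      subst h1 h2
      exact absurd hl (not_lt.2 (le_of_lt h))
    · simp at hc
  · rw [← mul_one (x i j h t), x_mul_apply_inl, mat_one_apply, mat_one_apply, if_pos rfl]
    by_cases hk : k = i
    · simp [hk, hne.symm]
    · simp [hk]

theorem longRoot_mem_U (j : Fin n) (t : K) : longRoot j t ∈ U n K := by
  refine mem_U_of_mem_unipotentShape ⟨fun k l => ?_, fun k l hl => ?_, fun k => ?_⟩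
  · simp [mat_longRoot]
  · simp [mat_longRoot, hl.ne']
  · simp [mat_longRoot]

theorem c_pow_four (j : Fin n) : (c j * c j * c j * c j : Sp n K) = 1 := by
  refine ext_mat fun P Q => ?_
  rw [mul_assoc, mul_assoc, ← mul_one (c j * (c j * (c j * c j))), mul_assoc, mul_assoc, mul_assoc]
  rcases P with k | k <;> by_cases hk : k = j <;>
    simp [-mul_one, c_mul_apply_inl, c_mul_apply_inr, hk]

theorem mul_inv_c_apply_inl (j : Fin n) (g : Sp n K) (P : Fin n ⊕ Fin n) (l : Fin n) :
    mat (g * (c j)⁻¹) P (.inl l) = if l = j then -mat g P (.inr j) else mat g P (.inl l) := by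
  have h : g = g * (c j)⁻¹ * c j := by group
  conv_rhs => rw [h, mul_c_apply_inl, mul_c_apply_inr]
  by_cases hl : l = j
  · rw [if_pos hl, if_pos rfl, hl, neg_neg]
  · rw [if_neg hl, if_neg hl]

theorem mul_inv_c_apply_inr (j : Fin n) (g : Sp n K) (P : Fin n ⊕ Fin n) (l : Fin n) :
    mat (g * (c j)⁻¹) P (.inr l) = if l = j then mat g P (.inl j) else mat g P (.inr l) := by
  have h : g = g * (c j)⁻¹ * c j := by group
  conv_rhs => rw [h, mul_c_apply_inl, mul_c_apply_inr]
  by_cases hl : l = j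
  · rw [if_pos hl, if_pos rfl, hl]
  · rw [if_neg hl, if_neg hl]

theorem inv_c_mul_apply_of_ne {i j : Fin n} (hij : i ≠ j) (g : Sp n K) (Q : Fin n ⊕ Fin n) :
    mat ((c j)⁻¹ * g) (.inl i) Q = mat g (.inl i) Q := by
  have h : g = c j * ((c j)⁻¹ * g) := by group
  conv_rhs => rw [h, c_mul_apply_inl, if_neg hij]

/-- The radical of the parabolic attached to the short simple root `u_i, u_{i+1}` is normalized
by `w_i`. -/
theorem w_conj_mem [Finite K] {i j : Fin n} (hij : (i : ℕ) + 1 = j) {v : Sp n K}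
    (hv : v ∈ U n K) (h0 : mat v (.inl i) (.inl j) = 0) :
    w i j * v * (w i j)⁻¹ ∈ U n K ∧ mat (w i j * v * (w i j)⁻¹) (.inl i) (.inl j) = 0 := by
  have hw : (w i j : Sp n K)⁻¹ = w i j := inv_eq_of_mul_eq_one_right (w_mul_w i j)
  rw [mem_U_iff, mem_unipotentShape] at *
  obtain ⟨h1, h2, h3⟩ := hv
  have hlt : i < j := by rw [Fin.lt_def]; omega
  rw [hw]
  simp only [mul_w_apply, w_mul_apply, Sum.map_inl, Sum.map_inr]
  refine ⟨⟨fun k l => h1 _ _, fun k l hl => ?_, fun k => h3 _⟩, ?_⟩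
  · by_cases hk : k = j ∧ l = i
    · rw [hk.1, hk.2, Equiv.swap_apply_left, Equiv.swap_apply_right, h0]
    -- Exchanging adjacent indices reverses the order of no other pair.
    · refine h2 _ _ ?_
      rw [Equiv.swap_apply_def, Equiv.swap_apply_def]
      simp only [Fin.ext_iff, Fin.lt_def] at *
      split_ifs <;> omega
  · rw [Equiv.swap_apply_left, Equiv.swap_apply_right, h2 _ _ hlt]

theorem apply_last_inl {j : Fin n} (hj : (j : ℕ) + 1 = n) {u : Sp n K}
    (hu : u ∈ unipotentShape n K) (l : Fin n) :
    mat u (.inl j) (.inl l) = if l = j then 1 else 0 := by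
  split_ifs with hl
  · rw [hl, hu.2.2]
  · refine hu.2.1 _ _ ?_
    simp only [Fin.ext_iff, Fin.lt_def] at *
    omega

/-- The left half of row `u_n` is that of the identity, so pairing this row with row `v_k` isolates
the entry in column `v_n`. -/
theorem apply_inr_last {j : Fin n} (hj : (j : ℕ) + 1 = n) {u : Sp n K}
    (hu : u ∈ unipotentShape n K) (k : Fin n) :
    mat u (.inr k) (.inr j) = if j = k then 1 else 0 := by
  rw [← row_inl_inr u j k]
  simp [apply_last_inl hj hu, hu.1]

/-- The radical of the parabolic attached to the long simple root is normalized by `c_n`. -/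
theorem c_conj_mem [Finite K] {j : Fin n} (hj : (j : ℕ) + 1 = n) {v : Sp n K}
    (hv : v ∈ U n K) (h0 : mat v (.inl j) (.inr j) = 0) :
    c j * v * (c j)⁻¹ ∈ U n K ∧ mat (c j * v * (c j)⁻¹) (.inl j) (.inr j) = 0 := by
  rw [mem_U_iff] at *
  have hD := apply_inr_last hj hv
  have hA := apply_last_inl hj hv
  obtain ⟨h1, h2, h3⟩ := hv
  rw [mem_unipotentShape]
  simp only [mul_inv_c_apply_inl, mul_inv_c_apply_inr, c_mul_apply_inl, c_mul_apply_inr]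
  refine ⟨⟨fun k l => ?_, fun k l hl => ?_, fun k => ?_⟩, ?_⟩
  · by_cases hk : k = j <;> by_cases hl : l = j <;>
      simp [hk, hl, h0, h1, hD, hA, eq_comm (a := j) (b := k)]
  · have hlj : l ≠ j := by
      simp only [Fin.ext_iff, Fin.lt_def, ne_eq] at *
      omega
    by_cases hk : k = j <;> simp [hk, hlj, h1, h2 k l hl]
  · by_cases hk : k = j <;> simp [hk, hD, h3]
  · simp [h1]

theorem w_conj_iff [Finite K] {i j : Fin n} (hij : (i : ℕ) + 1 = j) (v : Sp n K) :
    (v ∈ U n K ∧ mat v (.inl i) (.inl j) = 0) ↔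
      (w i j * v * (w i j)⁻¹ ∈ U n K ∧ mat (w i j * v * (w i j)⁻¹) (.inl i) (.inl j) = 0) := by
  refine ⟨fun h => w_conj_mem hij h.1 h.2, fun h => ?_⟩
  have h' := w_conj_mem hij h.1 h.2
  have e : w i j * (w i j * v * (w i j)⁻¹) * (w i j)⁻¹ = v := by
    rw [show w i j * (w i j * v * (w i j)⁻¹) * (w i j)⁻¹ =
      w i j * w i j * v * (w i j * w i j)⁻¹ by group, w_mul_w]
    group
  rwa [e] at h'

theorem c_conj_iff [Finite K] {j : Fin n} (hj : (j : ℕ) + 1 = n) (v : Sp n K) :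
    (v ∈ U n K ∧ mat v (.inl j) (.inr j) = 0) ↔
      (c j * v * (c j)⁻¹ ∈ U n K ∧ mat (c j * v * (c j)⁻¹) (.inl j) (.inr j) = 0) := by
  have hstep := fun {v : Sp n K} (h : v ∈ U n K ∧ mat v (.inl j) (.inr j) = 0) =>
    c_conj_mem hj h.1 h.2
  refine ⟨hstep, fun h => ?_⟩
  -- `c j` has fourth power `1`, so three further conjugations undo the first.
  have h' := hstep (hstep (hstep h))
  have e : c j * (c j * (c j * (c j * v * (c j)⁻¹) * (c j)⁻¹) * (c j)⁻¹) * (c j)⁻¹ = v := by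
    rw [show c j * (c j * (c j * (c j * v * (c j)⁻¹) * (c j)⁻¹) * (c j)⁻¹) * (c j)⁻¹ =
      c j * c j * c j * c j * v * (c j * c j * c j * c j)⁻¹ by group, c_pow_four]
    group
  rwa [e] at h'

theorem form_vVec (y : Fin n ⊕ Fin n → K) (j : Fin n) : form y (vVec j) = y (.inl j) := by
  simp [form, vVec, Pi.single_apply]

theorem chi_vVec {F : Type*} [Field F] (lam : AddChar K F) (j : Fin n) (g : Sp n K) :
    (chi lam (vVec j) g)⁻¹ = lam (-mat g (.inl j) (.inr j)) := by
  rw [chi, form_vVec, AddChar.map_neg_eq_inv]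
  simp [vVec]

/-- The entry `(u_j, v_i)` of an element of `U`, for `i, j` the last two indices. -/
theorem apply_last_inr {i j : Fin n} (hij : (i : ℕ) + 1 = j) (hj : (j : ℕ) + 1 = n) {u : Sp n K}
    (hu : u ∈ unipotentShape n K) :
    mat u (.inl j) (.inr i) = mat u (.inl i) (.inr j) -
      mat u (.inl i) (.inl j) * mat u (.inl j) (.inr j) := by
  have hne : i ≠ j := fun h => by rw [h] at hij; omega
  have h := row_inl_inl u i j
  rw [Finset.sum_sub_distrib] at h
  rw [Finset.sum_eq_add i j hne, hu.2.2] at h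
  · simp [apply_last_inl hj hu] at h
    linear_combination h
  · intro m _ hm
    rw [hu.2.1 i m, zero_mul]
    simp only [Fin.ext_iff, Fin.lt_def, ne_eq] at *
    omega
  · simp
  · simp

end LastTwo

/-! ### Coefficients of `w e_χ` and of `c_n w e_χ` -/

section Coefficients

variable {n : ℕ} {K : Type*} [Field K] [Fintype K] {F : Type*} [Field F] [CharP F 2]

/-- The coefficients of `w_{n-1} e_χ`. -/
def shortCoeff (lam : AddChar K F) (i j : Fin n) (u : Sp n K) : F :=
  lam (-(mat u (.inl i) (.inr i) + mat u (.inl i) (.inl j) * mat u (.inl i) (.inr j)))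

theorem reflectCoeff_w (h2 : (2 : K) ≠ 0) (lam : AddChar K F) {i j : Fin n} (h : (i : ℕ) < j)
    (u : Sp n K) :
    reflectCoeff (w i j) (x i j h) (fun g => mat g (.inl i) (.inl j)) 1
      (fun g => (chi lam (vVec j) g)⁻¹) u = shortCoeff lam i j u := by
  have hne : i ≠ j := Fin.ne_of_lt h
  have hw : (w i j : Sp n K)⁻¹ = w i j := inv_eq_of_mul_eq_one_right (w_mul_w i j)
  simp only [reflectCoeff, chi_vVec, hw, shortCoeff, mul_x_apply_inr, mul_w_apply, w_mul_apply,
    Sum.map_inl, Sum.map_inr, Equiv.swap_apply_right, if_neg hne.symm, sub_zero, if_true]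
  split_ifs with h0
  · rw [h0, zero_mul, add_zero]
    -- The summand does not depend on the root parameter; an odd number of equal terms adds up to
    -- one of them.
    exact sum_even_function h2 _ fun _ => rfl
  · congr 1
    ring

/-- For `b ≠ 0`, completing the square leaves a Gauss sum, which collapses to its term at `0`. For
`b = 0` and `t ≠ 0` both sides are sums of nontrivial characters, hence zero; for `t = 0` they agree
termwise. -/
theorem sum_addChar_quadratic (h2 : (2 : K) ≠ 0) (lam : AddChar K F) (hlam : lam ≠ 1)
    (p s t b : K) [Decidable (b = 0)] :
    ∑ α, lam (-(s + p * t + 2 * α * t + α ^ 2 * b)) =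
      if b = 0 then ∑ β, lam (-(s + t * (-p + β * t)))
      else lam (-(s + (t - b * p) * (-p + (-1 * b⁻¹) * (t - b * p)))) := by
  split_ifs with hb
  · subst hb
    by_cases ht : t = 0
    · simp [ht]
    · have e1 : ∀ α, lam (-(s + p * t + 2 * α * t + α ^ 2 * 0)) =
          lam (-(s + p * t)) * lam (α * (-(2 * t))) := fun α => by
        rw [← AddChar.map_add_eq_mul]
        congr 1
        ring
      have e2 : ∀ β, lam (-(s + t * (-p + β * t))) =
          lam (-(s - t * p)) * lam (β * (-(t * t))) := fun β => by
        rw [← AddChar.map_add_eq_mul]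
        congr 1
        ring
      simp only [e1, e2, ← Finset.mul_sum]
      rw [sum_addChar_mul lam hlam (neg_ne_zero.2 (mul_ne_zero h2 ht)),
        sum_addChar_mul lam hlam (neg_ne_zero.2 (mul_ne_zero ht ht)), mul_zero, mul_zero]
  · have h : ∑ α, lam (-(s + p * t + 2 * α * t + α ^ 2 * b)) =
        ∑ α, lam (-(s + p * t - t ^ 2 * b⁻¹) - α ^ 2 * b) := by
      refine Fintype.sum_equiv (Equiv.addRight (t * b⁻¹)) _ _ fun α => ?_
      congr 1
      simp only [Equiv.coe_addRight]
      field_simp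
      ring
    rw [h, sum_even_function h2 _ fun α => by rw [neg_sq]]
    congr 1
    field_simp
    ring

/-- `c j` and the long root group leave row `u_i` alone on the left, so only columns `u_j` and `v_j`
of that row change. On the other side, orthogonality of rows `u_i` and `u_j` rewrites the entry
`(u_j, v_i)` as `t - p b`, producing the quadratic polynomial in `α`. -/
theorem reflectCoeff_c (h2 : (2 : K) ≠ 0) (lam : AddChar K F) (hlam : lam ≠ 1) {i j : Fin n}
    (hij : (i : ℕ) + 1 = j) (hj : (j : ℕ) + 1 = n) (h : (i : ℕ) < j) {u : Sp n K}
    (hu : u ∈ U n K) :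
    reflectCoeff (c j) (longRoot j) (fun g => mat g (.inl j) (.inr j)) (-1)
      (shortCoeff lam i j) u = ∑ α, shortCoeff lam i j (x i j h α * u) := by
  classical
  have hne : i ≠ j := Fin.ne_of_lt h
  rw [mem_U_iff] at hu
  have hrow := apply_last_inr hij hj hu
  have hjj := hu.2.2 j
  simp only [shortCoeff, x_mul_apply_inl, if_true, hrow, hjj]
  have e : ∀ α, lam (-(mat u (.inl i) (.inr i) + α * (mat u (.inl i) (.inr j) -
        mat u (.inl i) (.inl j) * mat u (.inl j) (.inr j)) +
      (mat u (.inl i) (.inl j) + α * 1) *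
        (mat u (.inl i) (.inr j) + α * mat u (.inl j) (.inr j)))) =
      lam (-(mat u (.inl i) (.inr i) + mat u (.inl i) (.inl j) * mat u (.inl i) (.inr j) +
        2 * α * mat u (.inl i) (.inr j) + α ^ 2 * mat u (.inl j) (.inr j))) := fun α => by
    congr 1
    ring
  simp only [e]
  rw [sum_addChar_quadratic h2 lam hlam]
  simp only [reflectCoeff, shortCoeff, mul_assoc (c j)⁻¹, inv_c_mul_apply_of_ne hne,
    mul_longRoot_apply_inl, mul_longRoot_apply_inr, mul_c_apply_inl, mul_c_apply_inr,
    if_neg hne, if_true, add_zero]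
  split_ifs with h0
  · rfl
  · congr 1
    ring

end Coefficients

end SpSteinberg

/-! ### The identity in the Steinberg module -/

open SpSteinberg in
theorem mainTheorem5
    (p : ℕ) [Fact p.Prime] (hp : p ≠ 2)
    (K : Type*) [Field K] [Fintype K] [CharP K p]
    (F : Type*) [Field F] [CharP F 2]
    (lam : AddChar K F) (hlam : lam ≠ 1)
    (n : ℕ)
    -- `i` and `j` are the last two indices, written `n - 1` and `n` when counting from `1`
    (i j : Fin n) (hij : (i : ℕ) + 1 = j) (hj : (j : ℕ) + 1 = n)
    -- a choice of representatives `n_w ∈ W_2` of the elements `w` of the Weyl group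
    (r : Weyl n K → W₂ n K) (hr : ∀ y, (QuotientGroup.mk (r y) : Weyl n K) = y) :
    act (c i) (eChar r (chi lam (vVec j))) =
      ∑ α : K, act (w i j * x i j (by omega) (-α) * w i j) (eChar r (chi lam (vVec j))) := by
  classical
  have h2 : (2 : K) ≠ 0 := Ring.two_ne_zero ((ringChar.eq K p).symm ▸ hp)
  have h : (i : ℕ) < j := by omega
  have : Fintype (Sp n K) := Fintype.ofFinite _
  let ρ := MonoidAlgebra.of F (Sp n K)
  let e := steinbergElt F r
  have hact : ∀ (g : Sp n K) (z : steinbergModule F r), (act g z).1 = ρ g * z.1 := fun _ _ => rfl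
  have hchar : (eChar r (chi lam (vVec j))).1 =
      ∑ u with u ∈ U n K, (chi lam (vVec j) u)⁻¹ • (ρ u * e) := by
    rw [Finset.sum_subtype (p := (· ∈ U n K)) _ (by simp), eChar, AddSubmonoidClass.coe_finsetSum]
    rfl
  have hw : ρ (w i j) * (eChar r (chi lam (vVec j))).1 =
      ∑ u with u ∈ U n K, shortCoeff lam i j u • (ρ u * e) := by
    rw [hchar, reflect_sum ρ (U n K) (w i j) (x i j h) (fun g => mat g (.inl i) (.inl j))
      (x_mem_U h) (x_zero i j h) (x_mul_x i j h)
      (fun u hu t => by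
        rw [mul_x_apply_inl, if_pos rfl, (mem_U_iff.1 hu).2.2, mul_one])
      (w_conj_iff hij) (κ := 1) (mul_one 1) (of_mul_steinbergElt hr (W₂_w_mem hij))
      (fun t ht => w_mul_x_mul_steinbergElt hr hij h ht)]
    exact Finset.sum_congr rfl fun u _ => by rw [reflectCoeff_w h2]
  have hc : ρ (c j) * ∑ u with u ∈ U n K, shortCoeff lam i j u • (ρ u * e) =
      ∑ u with u ∈ U n K, (∑ α, shortCoeff lam i j (x i j h α * u)) • (ρ u * e) := by
    rw [reflect_sum ρ (U n K) (c j) (longRoot j) (fun g => mat g (.inl j) (.inr j))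
      (longRoot_mem_U j) (longRoot_zero j) (longRoot_mul_longRoot j)
      (fun u hu t => by
        rw [mul_longRoot_apply_inr, if_pos rfl, (mem_U_iff.1 hu).2.2, mul_one])
      (c_conj_iff hj) (κ := -1) (by ring) (of_mul_steinbergElt hr (W₂_c_mem j))
      (fun t ht => c_mul_longRoot_mul_steinbergElt hr j ht)]
    exact Finset.sum_congr rfl fun u hu => by
      rw [reflectCoeff_c h2 lam hlam hij hj h (Finset.mem_filter.1 hu).2]
  -- Translating the summation variable by `x(-α)` puts `x(α) u` in the coefficient, which explains
  -- the sign in the theorem.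
  have hx : ∀ α, ρ (x i j h (-α)) * ∑ u with u ∈ U n K, shortCoeff lam i j u • (ρ u * e) =
      ∑ u with u ∈ U n K, shortCoeff lam i j (x i j h α * u) • (ρ u * e) := fun α => by
    rw [Finset.mul_sum]
    refine Finset.sum_nbij' (fun u => x i j h (-α) * u) (fun u => x i j h α * u) ?_ ?_ ?_ ?_ ?_
    · intro u hu
      simpa [Subgroup.mul_mem_cancel_left _ (x_mem_U h (-α))] using hu
    · intro u hu
      simpa [Subgroup.mul_mem_cancel_left _ (x_mem_U h α)] using hu
    · intro u _
      rw [← mul_assoc, x_mul_x, add_neg_cancel, x_zero, one_mul]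
    · intro u _
      rw [← mul_assoc, x_mul_x, neg_add_cancel, x_zero, one_mul]
    · intro u _
      rw [← mul_assoc (x i j h α), x_mul_x, add_neg_cancel, x_zero, one_mul, mul_smul_comm,
        ← mul_assoc, ← map_mul]
  apply Subtype.ext
  -- Here `c i` becomes `w c_j w`; each term on the right also begins with `w`, which is factored
  -- out below.
  rw [AddSubmonoidClass.coe_finsetSum, hact, ← w_mul_c_mul_w i j, map_mul, map_mul, mul_assoc, hw,
    mul_assoc, hc]
  have hterm : ∀ α, (act (w i j * x i j h (-α) * w i j) (eChar r (chi lam (vVec j)))).1 =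
      ρ (w i j) * ∑ u with u ∈ U n K, shortCoeff lam i j (x i j h α * u) • (ρ u * e) := fun α => by
    rw [hact, map_mul, map_mul, mul_assoc, hw, mul_assoc, hx]
  rw [Finset.sum_congr rfl fun α _ => hterm α, ← Finset.mul_sum, Finset.sum_comm]
  congr 1
  exact Finset.sum_congr rfl fun u _ => Finset.sum_smul
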